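/- Let $(\Omega,\mathcal F,\mathbb P)$ be an atomless probability space (equivalently, one carrying a random variable uniformly distributed on $[0,1]$), let $q\in[1,\infty)$, let $L^q$ be the normed space of random variables with finite $q$-th moment, and let $\mathcal M_{L^q}$ be the set of their distributions, written as distribution functions. Let $h:[0,1]\to\mathbb R$ be of bounded variation with $h(0)=0$, and let $$I_h(F)=\int_0^\infty h(1-F(x))\,\mathrm dx+\int_{-\infty}^0\bigl(h(1-F(x))-h(1)\bigr)\,\mathrm dx ,$$ with $I_h(X)=I_h(F)$ when $X$ has distribution $F$. Suppose that both integrals are finite for every $F\in\mathcal M_{L^q}$ and that $X\mapsto I_h(X)$ is continuous on $L^q$ with respect to the $L^q$-norm. Then the following are equivalent: (i) $h$ is convex on $[0,1]$; (ii) $I_h(F)\le I_h(G)$ for all $F,G\in\mathcal M_{L^q}$ such that $\int f\,\mathrm dF\le\int f\,\mathrm dG$ for all concave $f:\mathbb R\to\mathbb R$ (integrals with values in $[-\infty,\infty)$); (iii) $I_h(X+Y)\ge I_h(X)+I_h(Y)$ for all $X,Y\in L^q$; (iv) $X\mapsto I_h(X)$ is concave on $L^q$; (v) $X\mapsto I_h(X)$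 is quasi-concave on $L^q$; (vi) $I_h(\lambda F+(1-\lambda)G)\le\lambda I_h(F)+(1-\lambda)I_h(G)$ for all $F,G\in\mathcal M_{L^q}$ and $\lambda\in[0,1]$; (vii) $I_h(\lambda F+(1-\lambda)G)\le\max\{I_h(F),I_h(G)\}$ for all $F,G\in\mathcal M_{L^q}$ and $\lambda\in[0,1]$. Moreover, for all $\alpha\in(0,1)$ and $c\in[0,1]$, the mixed quantile $Q_\alpha^c=cQ_\alpha^++(1-c)Q_\alpha^-$, where $Q_\alpha^+(F)=\inf\{x:F(x)>\alpha\}$ and $Q_\alpha^-(F)=\inf\{x:F(x)\ge\alpha\}$, is not continuous on $L^q$ with respect to the $L^q$-norm (as the map sending $X$ to the value of $Q_\alpha^c$ at the distribution of $X$). -/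

import Mathlib

open MeasureTheory ProbabilityTheory Set
open scoped ENNReal

noncomputable section

namespace SignedChoquet

/-- A distortion function: `h : [0,1] → ℝ` of bounded variation with `h 0 = 0`.
Only the values of `h` on `[0,1]` are ever used. -/
structure IsDistortion (h : ℝ → ℝ) : Prop where
  boundedVariation : BoundedVariationOn h (Icc 0 1)
  map_zero : h 0 = 0

/-- The signed Choquet integral of a distribution `μ` with distribution function `F`:
`I_h(F) = ∫_0^∞ h(1 - F(x)) dx + ∫_{-∞}^0 (h(1 - F(x)) - h(1)) dx`. -/
def choquet (h : ℝ → ℝ) (μ : Measure ℝ) : ℝ :=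
  (∫ x in Ioi (0 : ℝ), h (1 - cdf μ x)) + ∫ x in Iio (0 : ℝ), (h (1 - cdf μ x) - h 1)

/-- Both integrals in the definition of `I_h(F)` are finite. -/
def HasFiniteChoquet (h : ℝ → ℝ) (μ : Measure ℝ) : Prop :=
  IntegrableOn (fun x => h (1 - cdf μ x)) (Ioi (0 : ℝ)) ∧
    IntegrableOn (fun x => h (1 - cdf μ x) - h 1) (Iio (0 : ℝ))

/-- The mixture `t F + (1 - t) G` of two distributions, for `t ∈ [0,1]`. -/
def mixture (t : ℝ) (μ ν : Measure ℝ) : Measure ℝ :=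
  ENNReal.ofReal t • μ + ENNReal.ofReal (1 - t) • ν

/-- `ρ` is convex in mixtures on the set `M` of distributions. -/
def MConvexOn (M : Set (Measure ℝ)) (ρ : Measure ℝ → ℝ) : Prop :=
  ∀ μ ∈ M, ∀ ν ∈ M, ∀ t ∈ Icc (0 : ℝ) 1, ρ (mixture t μ ν) ≤ t * ρ μ + (1 - t) * ρ ν

/-- `ρ` is quasi-convex in mixtures on the set `M` of distributions. -/
def MQuasiConvexOn (M : Set (Measure ℝ)) (ρ : Measure ℝ → ℝ) : Prop :=
  ∀ μ ∈ M, ∀ ν ∈ M, ∀ t ∈ Icc (0 : ℝ) 1, ρ (mixture t μ ν) ≤ max (ρ μ) (ρ ν)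

/-- Concave order: `∫ f dμ ≤ ∫ f dν` for all concave `f : ℝ → ℝ`.
For distributions with finite mean the integral of a concave function exists in `[-∞, ∞)`, and it
is `-∞` exactly when the function is not integrable; the clause below is the inequality between
these extended values. -/
def ConcaveOrderLE (μ ν : Measure ℝ) : Prop :=
  ∀ f : ℝ → ℝ, ConcaveOn ℝ univ f → Integrable f μ →
    Integrable f ν ∧ ∫ x, f x ∂μ ≤ ∫ x, f x ∂ν

/-- `ρ` is monotone for the concave order on the set `M` of distributions. -/
def ConcaveOrderMonotoneOn (M : Set (Measure ℝ)) (ρ : Measure ℝ → ℝ) : Prop :=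
  ∀ μ ∈ M, ∀ ν ∈ M, ConcaveOrderLE μ ν → ρ μ ≤ ρ ν

/-- The left quantile `inf {x | F(x) ≥ α}`, for `α ∈ (0,1)`. -/
def leftQuantile (α : ℝ) (μ : Measure ℝ) : ℝ := sInf {x | α ≤ cdf μ x}

/-- The right quantile `inf {x | F(x) > α}`, for `α ∈ (0,1)`. -/
def rightQuantile (α : ℝ) (μ : Measure ℝ) : ℝ := sInf {x | α < cdf μ x}

/-- The mixed quantile `c Q⁺_α + (1 - c) Q⁻_α`. -/
def mixedQuantile (c α : ℝ) (μ : Measure ℝ) : ℝ :=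
  c * rightQuantile α μ + (1 - c) * leftQuantile α μ

variable {Ω : Type*} [MeasurableSpace Ω]

/-- The probability space carries a random variable that is uniform on `[0,1]`
(for a probability space this is the same as being atomless). -/
def SupportsUniform (P : Measure Ω) : Prop :=
  ∃ U : Ω → ℝ, Measurable U ∧ P.map U = (volume : Measure ℝ).restrict (Icc 0 1)

/-- The distribution of an element of `L^q`. -/
def law {P : Measure Ω} {q : ℝ≥0∞} (X : Lp ℝ q P) : Measure ℝ := P.map X

/-- The set of the distributions of all random variables in `L^q`. -/
def lawsLp (P : Measure Ω) (q : ℝ≥0∞) : Set (Measure ℝ) :=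
  Set.range (fun X : Lp ℝ q P => law X)

end SignedChoquet

end

/-! Continuity of `h` comes first. If `U` is uniform, `s ↦ 1_{U ≤ s}` is a continuous path in `L^q`
(as `q < ∞`), and `I_h` takes the value `h s` along it. A mixed quantile at level `α` jumps from 0
to 1 on this path at `s = 1 - α`, so it cannot be continuous.

Convexity is sufficient because a convex `h` is the limit of its piecewise linear interpolants, each
a linear function plus a nonnegative combination of hinges `(s - k)⁺`. For a hinge, `I(X) = max_y
((1 - k) y - E (y - X)⁺)`. This variational formula (`le_choquet_hinge`, `exists_choquet_hinge_eq`)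
makes hinge functionals monotone in the concave order and superlinear on `L^q`. The linear part of
`h` contributes the mean, and `tendsto_choquet_interp` passes to the limit by dominated convergence.
Convexity in mixtures is simpler: survival functions mix linearly, so convexity of `h` applies under
the integral.

Convexity is necessary for (ii), (iii) and (v) by one construction: events `A ⊆ B` of probabilities
`a ≤ b`, and `M`, `N` of probability `(a + b) / 2` with `1_M + 1_N = 1_A + 1_B`. As `I_h(1_A + 1_B)
= h a + h b`, each property gives midpoint convexity, which suffices by continuity.

Quasi-convexity in mixtures is the delicate case. Laws with two steps turn it into quasi-convexity
of `d₁ h(s₁) + d₂ h(s₂)` for all weights. If `h` had negative symmetric second differences at some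
`p`, balancing the weights would bound the increments of `h` away from `p` by its second
differences. Summed over a fine grid, this forces `h 0 = h p = h 1` and contradicts the choice of
`p` (`convexOn_of_weighted_quasiconvex`). -/

namespace SignedChoquet

open Filter Topology

/-! ### Two-step laws and their mixtures -/

/-- The distribution function of `μ` is that of a law taking the values `0`, `d₁`, `d₁ + d₂`, with
survival probabilities `s₁` on `[0, d₁)` and `s₂` on `[d₁, d₁ + d₂)`. -/
structure IsTwoStep (μ : Measure ℝ) (d₁ d₂ s₁ s₂ : ℝ) : Prop where
  neg : ∀ x < 0, cdf μ x = 0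
  fst : ∀ x ∈ Ico 0 d₁, cdf μ x = 1 - s₁
  snd : ∀ x ∈ Ico d₁ (d₁ + d₂), cdf μ x = 1 - s₂
  top : ∀ x, d₁ + d₂ ≤ x → cdf μ x = 1

lemma IsTwoStep.choquet_eq {μ : Measure ℝ} {d₁ d₂ s₁ s₂ : ℝ} (hμ : IsTwoStep μ d₁ d₂ s₁ s₂)
    {h : ℝ → ℝ} (h0 : h 0 = 0) (hd₁ : 0 ≤ d₁) (hd₂ : 0 ≤ d₂) :
    choquet h μ = d₁ * h s₁ + d₂ * h s₂ := by
  have e1 : ∫ x in Iio (0 : ℝ), (h (1 - cdf μ x) - h 1) = 0 := by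
    refine setIntegral_eq_zero_of_forall_eq_zero fun x hx => ?_
    rw [hμ.neg x hx]; simp
  have e2 : ∫ x in Ici (0 : ℝ), h (1 - cdf μ x) =
      ∫ x in Ici (0 : ℝ), ((Ico 0 d₁).indicator (fun _ => h s₁) x +
        (Ico d₁ (d₁ + d₂)).indicator (fun _ => h s₂) x) := by
    refine setIntegral_congr_fun measurableSet_Ici fun x hx => ?_
    have hx : 0 ≤ x := hx
    rcases lt_or_ge x d₁ with h1 | h1
    · have hm : x ∉ Ico d₁ (d₁ + d₂) := fun hm => absurd hm.1 (not_le.2 h1)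
      simp [hμ.fst x ⟨hx, h1⟩, hx, h1, hm]
    · have hm : x ∉ Ico 0 d₁ := fun hm => absurd hm.2 (not_lt.2 h1)
      rcases lt_or_ge x (d₁ + d₂) with h2 | h2
      · simp [hμ.snd x ⟨h1, h2⟩, h2, h1, hm]
      · have hm' : x ∉ Ico d₁ (d₁ + d₂) := fun hm => absurd hm.2 (not_lt.2 h2)
        simp [hμ.top x h2, h0, hm, hm']
  have i1 (a b c : ℝ) : Integrable ((Ico a b).indicator fun _ => c) :=
    (integrable_indicator_iff measurableSet_Ico).2 (integrableOn_const (by simp))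
  have s1 : Ici (0 : ℝ) ∩ Ico 0 d₁ = Ico 0 d₁ := inter_eq_right.2 fun x hx => hx.1
  have s2 : Ici (0 : ℝ) ∩ Ico d₁ (d₁ + d₂) = Ico d₁ (d₁ + d₂) :=
    inter_eq_right.2 fun x hx => hd₁.trans hx.1
  rw [choquet, e1, add_zero, ← integral_Ici_eq_integral_Ioi, e2,
    integral_add (i1 _ _ _).integrableOn (i1 _ _ _).integrableOn,
    setIntegral_indicator measurableSet_Ico, setIntegral_indicator measurableSet_Ico, s1, s2]
  simp [hd₁, hd₂]

lemma isProbabilityMeasure_mixture {μ ν : Measure ℝ} [IsProbabilityMeasure μ]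
    [IsProbabilityMeasure ν] {t : ℝ} (ht : t ∈ Icc (0 : ℝ) 1) :
    IsProbabilityMeasure (mixture t μ ν) := by
  constructor
  simp only [mixture, Measure.add_apply, Measure.smul_apply, measure_univ, smul_eq_mul, mul_one]
  rw [← ENNReal.ofReal_add ht.1 (by linarith [ht.2])]
  simp

lemma cdf_mixture {μ ν : Measure ℝ} [IsProbabilityMeasure μ] [IsProbabilityMeasure ν] {t : ℝ}
    (ht : t ∈ Icc (0 : ℝ) 1) (x : ℝ) :
    cdf (mixture t μ ν) x = t * cdf μ x + (1 - t) * cdf ν x := by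
  have := isProbabilityMeasure_mixture (μ := μ) (ν := ν) ht
  have ht' : 0 ≤ 1 - t := by linarith [ht.2]
  rw [cdf_eq_real, cdf_eq_real, cdf_eq_real, mixture, measureReal_add_apply
    (ENNReal.mul_ne_top ENNReal.ofReal_ne_top (measure_ne_top μ _))
    (ENNReal.mul_ne_top ENNReal.ofReal_ne_top (measure_ne_top ν _)),
    measureReal_ennreal_smul_apply, measureReal_ennreal_smul_apply,
    ENNReal.toReal_ofReal ht.1, ENNReal.toReal_ofReal ht']

/-- With common jump points, mixing only averages the survival probabilities. Mixture properties of
`choquet h` thus become inequalities for `h` alone. -/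
lemma IsTwoStep.mixture {μ ν : Measure ℝ} [IsProbabilityMeasure μ] [IsProbabilityMeasure ν]
    {d₁ d₂ s₁ s₂ r₁ r₂ t : ℝ} (hμ : IsTwoStep μ d₁ d₂ s₁ s₂) (hν : IsTwoStep ν d₁ d₂ r₁ r₂)
    (ht : t ∈ Icc (0 : ℝ) 1) :
    IsTwoStep (mixture t μ ν) d₁ d₂ (t * s₁ + (1 - t) * r₁) (t * s₂ + (1 - t) * r₂) where
  neg x hx := by rw [cdf_mixture ht, hμ.neg x hx, hν.neg x hx]; ring
  fst x hx := by rw [cdf_mixture ht, hμ.fst x hx, hν.fst x hx]; ring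
  snd x hx := by rw [cdf_mixture ht, hμ.snd x hx, hν.snd x hx]; ring
  top x hx := by rw [cdf_mixture ht, hμ.top x hx, hν.top x hx]; ring

/-! ### Nested events as two-step random variables in `L^q` -/

section Laws

variable {Ω : Type*} [MeasurableSpace Ω] {P : Measure Ω} {q : ℝ≥0∞}

lemma aemeasurable_Lp (X : Lp ℝ q P) : AEMeasurable X P :=
  (Lp.aestronglyMeasurable X).aemeasurable

variable [IsProbabilityMeasure P]

instance isProbabilityMeasure_law (X : Lp ℝ q P) : IsProbabilityMeasure (law X) :=
  Measure.isProbabilityMeasure_map (aemeasurable_Lp X)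

/-- The indicator of an event, as an element of `L^q`. -/
noncomputable def eventLp (P : Measure Ω) [IsProbabilityMeasure P] (q : ℝ≥0∞) {A : Set Ω}
    (hA : MeasurableSet A) : Lp ℝ q P :=
  indicatorConstLp q hA (measure_ne_top P A) (1 : ℝ)

lemma coeFn_nested {A B : Set Ω} (hA : MeasurableSet A) (hB : MeasurableSet B) (d₁ d₂ : ℝ) :
    (d₁ • eventLp P q hA + d₂ • eventLp P q hB : Lp ℝ q P) =ᵐ[P]
      fun ω => A.indicator (fun _ => d₁) ω + B.indicator (fun _ => d₂) ω := by
  have hA' : (eventLp P q hA : Ω → ℝ) =ᵐ[P] A.indicator fun _ => 1 := indicatorConstLp_coeFn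
  have hB' : (eventLp P q hB : Ω → ℝ) =ᵐ[P] B.indicator fun _ => 1 := indicatorConstLp_coeFn
  filter_upwards [Lp.coeFn_add (d₁ • eventLp P q hA) (d₂ • eventLp P q hB),
    Lp.coeFn_smul d₁ (eventLp P q hA), Lp.coeFn_smul d₂ (eventLp P q hB), hA', hB']
    with ω h1 h2 h3 h4 h5
  rw [h1, Pi.add_apply, h2, h3, Pi.smul_apply, Pi.smul_apply, h4, h5]
  simp [indicator]

lemma measurable_nested {A B : Set Ω} (hA : MeasurableSet A) (hB : MeasurableSet B) (d₁ d₂ : ℝ) :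
    Measurable fun ω => A.indicator (fun _ => d₁) ω + B.indicator (fun _ => d₂) ω :=
  (measurable_const.indicator hA).add (measurable_const.indicator hB)

lemma isTwoStep_law_nested {A B : Set Ω} (hA : MeasurableSet A) (hB : MeasurableSet B)
    (hBA : B ⊆ A) {d₁ d₂ : ℝ} (hd₁ : 0 ≤ d₁) (hd₂ : 0 ≤ d₂) :
    IsTwoStep (law (d₁ • eventLp P q hA + d₂ • eventLp P q hB)) d₁ d₂ (P.real A) (P.real B) := by
  set Z : Ω → ℝ := fun ω => A.indicator (fun _ => d₁) ω + B.indicator (fun _ => d₂) ω with hZ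
  have key (x : ℝ) : cdf (law (d₁ • eventLp P q hA + d₂ • eventLp P q hB)) x
      = P.real {ω | Z ω ≤ x} := by
    rw [cdf_eq_real, law, Measure.map_congr (coeFn_nested hA hB d₁ d₂),
      map_measureReal_apply (measurable_nested hA hB d₁ d₂) measurableSet_Iic]
    rfl
  have Z1 {ω} (h : ω ∉ A) : Z ω = 0 := by simp [hZ, h, show ω ∉ B from fun h' => h (hBA h')]
  have Z2 {ω} (h : ω ∈ A) (h' : ω ∉ B) : Z ω = d₁ := by simp [hZ, h, h']
  have Z3 {ω} (h : ω ∈ B) : Z ω = d₁ + d₂ := by simp [hZ, h, hBA h]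
  refine ⟨fun x hx => ?_, fun x hx => ?_, fun x hx => ?_, fun x hx => ?_⟩
  · rw [key, show {ω | Z ω ≤ x} = ∅ from ?_, measureReal_empty]
    refine eq_empty_of_forall_notMem fun ω hω => ?_
    have hω : Z ω ≤ x := hω
    by_cases h1 : ω ∈ A
    · by_cases h2 : ω ∈ B
      · rw [Z3 h2] at hω; linarith
      · rw [Z2 h1 h2] at hω; linarith
    · rw [Z1 h1] at hω; linarith
  · rw [key, show {ω | Z ω ≤ x} = Aᶜ from ?_, probReal_compl_eq_one_sub hA]
    ext ω
    simp only [mem_ofPred_eq, mem_compl_iff]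
    by_cases h1 : ω ∈ A
    · by_cases h2 : ω ∈ B
      · rw [Z3 h2]; simp only [h1, not_true_eq_false, iff_false]; linarith [hx.2]
      · rw [Z2 h1 h2]; simp only [h1, not_true_eq_false, iff_false]; linarith [hx.2]
    · rw [Z1 h1]; simp [h1, hx.1]
  · rw [key, show {ω | Z ω ≤ x} = Bᶜ from ?_, probReal_compl_eq_one_sub hB]
    ext ω
    simp only [mem_ofPred_eq, mem_compl_iff]
    by_cases h2 : ω ∈ B
    · rw [Z3 h2]; simp only [h2, not_true_eq_false, iff_false]; linarith [hx.2]
    · by_cases h1 : ω ∈ A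
      · rw [Z2 h1 h2]; simp [h2, hx.1]
      · rw [Z1 h1]; simp [h2, hd₁.trans hx.1]
  · rw [key, show {ω | Z ω ≤ x} = univ from ?_, probReal_univ]
    refine eq_univ_of_forall fun ω => ?_
    change Z ω ≤ x
    by_cases h1 : ω ∈ A
    · by_cases h2 : ω ∈ B
      · rwa [Z3 h2]
      · rw [Z2 h1 h2]; linarith
    · rw [Z1 h1]; linarith

lemma integral_law_nested {A B : Set Ω} (hA : MeasurableSet A) (hB : MeasurableSet B)
    (hBA : B ⊆ A) (d₁ d₂ : ℝ) {f : ℝ → ℝ} (hf : Measurable f) :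
    Integrable f (law (d₁ • eventLp P q hA + d₂ • eventLp P q hB)) ∧
      ∫ x, f x ∂(law (d₁ • eventLp P q hA + d₂ • eventLp P q hB)) =
        f 0 + (f d₁ - f 0) * P.real A + (f (d₁ + d₂) - f d₁) * P.real B := by
  have hZ := measurable_nested hA hB d₁ d₂
  have e : (f ∘ fun ω => A.indicator (fun _ => d₁) ω + B.indicator (fun _ => d₂) ω) =
      fun ω => f 0 + A.indicator (fun _ => f d₁ - f 0) ω
        + B.indicator (fun _ => f (d₁ + d₂) - f d₁) ω := by
    funext ω
    by_cases h1 : ω ∈ A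
    · by_cases h2 : ω ∈ B <;> simp [h1, h2]
    · simp [h1, show ω ∉ B from fun h' => h1 (hBA h')]
  have i1 (c : ℝ) {S : Set Ω} (hS : MeasurableSet S) : Integrable (S.indicator fun _ => c) P :=
    (integrable_const c).indicator hS
  rw [law, Measure.map_congr (coeFn_nested hA hB d₁ d₂)]
  constructor
  · rw [integrable_map_measure hf.aestronglyMeasurable hZ.aemeasurable, e]
    exact ((integrable_const _).add (i1 _ hA)).add (i1 _ hB)
  · rw [integral_map hZ.aemeasurable hf.aestronglyMeasurable]
    change ∫ ω, (f ∘ fun ω => A.indicator (fun _ => d₁) ω + B.indicator (fun _ => d₂) ω) ω ∂P = _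
    have a1 := integral_add (((integrable_const (f 0)).add (i1 (f d₁ - f 0) hA)))
      (i1 (f (d₁ + d₂) - f d₁) hB)
    have a2 := integral_add (integrable_const (f 0)) (i1 (f d₁ - f 0) hA)
    simp only [Pi.add_apply] at a1
    rw [e, a1, a2, integral_indicator_const _ hA, integral_indicator_const _ hB]
    simp [mul_comm]

lemma choquet_law_nested {A B : Set Ω} (hA : MeasurableSet A) (hB : MeasurableSet B)
    (hBA : B ⊆ A) {d₁ d₂ : ℝ} (hd₁ : 0 ≤ d₁) (hd₂ : 0 ≤ d₂) {h : ℝ → ℝ} (h0 : h 0 = 0) :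
    choquet h (law (d₁ • eventLp P q hA + d₂ • eventLp P q hB))
      = d₁ * h (P.real A) + d₂ * h (P.real B) :=
  (isTwoStep_law_nested hA hB hBA hd₁ hd₂).choquet_eq h0 hd₁ hd₂

lemma choquet_law_eventLp {A : Set Ω} (hA : MeasurableSet A) {h : ℝ → ℝ} (h0 : h 0 = 0) :
    choquet h (law (eventLp P q hA)) = h (P.real A) := by
  -- A single event is the degenerate pair `A ⊆ A` with weights `1` and `0`.
  have := choquet_law_nested (P := P) (q := q) hA hA subset_rfl zero_le_one le_rfl h0
  simpa using this

end Laws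

/-! ### Convexity criteria for continuous functions -/

/-- A continuous function that is not convex has a point around which all symmetric second
differences on a small scale are negative. -/
lemma exists_symmetric_concave_of_not_convexOn {h : ℝ → ℝ} (hc : ContinuousOn h (Icc 0 1))
    (hn : ¬ ConvexOn ℝ (Icc (0 : ℝ) 1) h) :
    ∃ p δ₀, 0 < δ₀ ∧ 0 ≤ p - δ₀ ∧ p + δ₀ ≤ 1 ∧
      ∀ δ, 0 < δ → δ ≤ δ₀ → h (p - δ) + h (p + δ) < 2 * h p := by
  have hn' : ∃ x ∈ Icc (0 : ℝ) 1, ∃ y ∈ Icc (0 : ℝ) 1, x < y ∧ ∃ a b : ℝ, 0 < a ∧ 0 < b ∧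
      a + b = 1 ∧ a * h x + b * h y < h (a * x + b * y) := by
    by_contra hcon
    refine hn (LinearOrder.convexOn_of_lt (convex_Icc 0 1) fun x hx y hy hxy a b ha hb hab => ?_)
    by_contra hlt
    exact hcon ⟨x, hx, y, hy, hxy, a, b, ha, hb, hab, not_le.1 hlt⟩
  obtain ⟨x, hx, y, hy, hxy, a, b, ha, hb, hab, hlt⟩ := hn'
  -- Subtracting the chord leaves symmetric second differences unchanged. The point `p` is the
  -- leftmost maximiser of the difference `g`: a step to the left strictly decreases `g` and a step
  -- to the right does not increase it. As `g p > 0`, `p` is interior.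
  set k := (h y - h x) / (y - x) with hk
  have hyx : 0 < y - x := sub_pos.2 hxy
  have hkm : k * (y - x) = h y - h x := div_mul_cancel₀ _ hyx.ne'
  set g : ℝ → ℝ := fun w => h w - h x - k * (w - x) with hg
  have hsub : Icc x y ⊆ Icc 0 1 := Icc_subset_Icc hx.1 hy.2
  have gc : ContinuousOn g (Icc x y) :=
    ((hc.mono hsub).sub continuousOn_const).sub (by fun_prop)
  obtain ⟨m, hm, hmax⟩ := isCompact_Icc.exists_isMaxOn (nonempty_Icc.2 hxy.le) gc
  have hcl : IsCompact (Icc x y ∩ g ⁻¹' {g m}) :=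
    isCompact_Icc.of_isClosed_subset (gc.preimage_isClosed_of_isClosed isClosed_Icc
      isClosed_singleton) inter_subset_left
  obtain ⟨p, ⟨hpI, hpm⟩, hleast⟩ := hcl.exists_isLeast ⟨m, hm, rfl⟩
  have hpm : g p = g m := hpm
  have gz : 0 < g (a * x + b * y) := by
    have : a = 1 - b := by linarith
    subst this
    simp only [hg]
    have : k * ((1 - b) * x + b * y - x) = b * (h y - h x) := by rw [← hkm]; ring
    rw [this]; linarith
  have hz : a * x + b * y ∈ Icc x y := by
    have : a = 1 - b := by linarith
    subst this
    constructor <;> nlinarith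
  have gm : 0 < g p := hpm ▸ gz.trans_le (hmax hz)
  have gx : g x = 0 := by simp [hg]
  have gy : g y = 0 := by simp [hg, hkm]
  have hxp : x < p := lt_of_le_of_ne hpI.1 fun e => by rw [← e, gx] at gm; exact lt_irrefl _ gm
  have hpy : p < y := lt_of_le_of_ne hpI.2 fun e => by rw [e, gy] at gm; exact lt_irrefl _ gm
  refine ⟨p, min (p - x) (y - p), lt_min (by linarith) (by linarith), ?_, ?_, fun δ h0 h1 => ?_⟩
  · linarith [min_le_left (p - x) (y - p), hx.1]
  · linarith [min_le_right (p - x) (y - p), hy.2]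
  · have hl := h1.trans (min_le_left _ _)
    have hr := h1.trans (min_le_right _ _)
    have i1 : p - δ ∈ Icc x y := ⟨by linarith, by linarith⟩
    have i2 : p + δ ∈ Icc x y := ⟨by linarith, by linarith⟩
    have l1 : g (p - δ) < g p := by
      refine lt_of_le_of_ne (hpm ▸ hmax i1) fun e => ?_
      have := hleast ⟨i1, e.trans hpm⟩
      linarith
    have l2 : g (p + δ) ≤ g p := hpm ▸ hmax i2
    simp only [hg] at l1 l2
    linarith

lemma convexOn_of_midpoint {h : ℝ → ℝ} (hc : ContinuousOn h (Icc 0 1))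
    (hm : ∀ a b, 0 ≤ a → a ≤ b → b ≤ 1 → 2 * h ((a + b) / 2) ≤ h a + h b) :
    ConvexOn ℝ (Icc (0 : ℝ) 1) h := by
  by_contra hn
  obtain ⟨p, δ, h0, h1, h2, h3⟩ := exists_symmetric_concave_of_not_convexOn hc hn
  have := hm (p - δ) (p + δ) h1 (by linarith) h2
  rw [show (p - δ + (p + δ)) / 2 = p by ring] at this
  linarith [h3 δ h0 le_rfl]

/-- Telescoping of second differences along a fine grid. -/
lemma mul_sub_nonpos_of_second_difference {h : ℝ → ℝ} {u v κ D : ℝ} (huv : u ≤ v)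
    (hc : ContinuousOn h (Icc u v))
    (H : ∀ y ∈ Icc u v, ∀ z ∈ Icc u v,
      κ * (h y - h z) ≤ D * (h y + h z - 2 * h ((y + z) / 2))) :
    κ * (h u - h v) ≤ 0 := by
  -- Summing `H` over grid points two steps apart leaves only boundary terms. As the mesh tends to
  -- 0, the left side tends to `2 κ (h u - h v)` and the right side, a difference of two boundary
  -- increments, tends to 0 whatever the sign of `D`.
  have grid (N : ℕ) : κ * (h u + h (u + (v - u) / (N + 1)) - h (v - (v - u) / (N + 1)) - h v)
      ≤ D * (h u - h (u + (v - u) / (N + 1)) - h (v - (v - u) / (N + 1)) + h v) := by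
    have hN : (0 : ℝ) < N + 1 := by positivity
    set ε := (v - u) / (N + 1) with hε
    have hε0 : 0 ≤ ε := div_nonneg (by linarith) hN.le
    have hεN : (N + 1) * ε = v - u := mul_div_cancel₀ _ hN.ne'
    have tel (j : ℕ) (hj : j ≤ N) :
        κ * (h u + h (u + ε) - h (u + j * ε) - h (u + (j + 1) * ε))
        ≤ D * (h u - h (u + ε) - h (u + j * ε) + h (u + (j + 1) * ε)) := by
      induction j with
      | zero => simp
      | succ j ih =>
        have ih := ih (by omega)
        have hj' : (j : ℝ) + 1 ≤ N := by exact_mod_cast hj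
        have hj0 : (0 : ℝ) ≤ j := j.cast_nonneg
        have m1 : u + j * ε ∈ Icc u v := ⟨by nlinarith, by nlinarith⟩
        have m2 : u + (j + 2) * ε ∈ Icc u v := ⟨by nlinarith, by nlinarith⟩
        have := H _ m1 _ m2
        rw [show (u + j * ε + (u + (j + 2) * ε)) / 2 = u + (j + 1) * ε by ring] at this
        push_cast
        rw [show (j : ℝ) + 1 + 1 = j + 2 by ring]
        linarith
    have := tel N le_rfl
    rwa [show u + (N : ℝ) * ε = v - ε by linarith,
      show u + ((N : ℝ) + 1) * ε = v by linarith] at this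
  have hz : Tendsto (fun N : ℕ => (v - u) / ((N : ℝ) + 1)) atTop (𝓝 0) := by
    have := (tendsto_one_div_add_atTop_nhds_zero_nat (𝕜 := ℝ)).const_mul (v - u)
    simpa [div_eq_mul_inv] using this
  have hb (N : ℕ) : 0 ≤ (v - u) / ((N : ℝ) + 1) ∧ (v - u) / ((N : ℝ) + 1) ≤ v - u :=
    ⟨div_nonneg (by linarith) (by positivity),
      div_le_self (by linarith) (by linarith [(N.cast_nonneg : (0 : ℝ) ≤ N)])⟩
  have t1 : Tendsto (fun N : ℕ => h (u + (v - u) / ((N : ℝ) + 1))) atTop (𝓝 (h u)) := by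
    refine (hc u ⟨le_rfl, huv⟩).tendsto.comp (tendsto_nhdsWithin_iff.2 ⟨?_, ?_⟩)
    · simpa using hz.const_add u
    · exact Eventually.of_forall fun N => ⟨by linarith [(hb N).1], by linarith [(hb N).2]⟩
  have t2 : Tendsto (fun N : ℕ => h (v - (v - u) / ((N : ℝ) + 1))) atTop (𝓝 (h v)) := by
    refine (hc v ⟨huv, le_rfl⟩).tendsto.comp (tendsto_nhdsWithin_iff.2 ⟨?_, ?_⟩)
    · simpa using hz.const_sub v
    · exact Eventually.of_forall fun N => ⟨by linarith [(hb N).2], by linarith [(hb N).1]⟩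
  have L := le_of_tendsto_of_tendsto' ((((t1.const_add (h u)).sub t2).sub_const (h v)).const_mul κ)
    ((((t1.const_sub (h u)).sub t2).add_const (h v)).const_mul D) grid
  have e : D * (h u - h u - h v + h v) = 0 := by ring
  rw [e] at L
  linarith

/-- If a weighted sum of two functions is midpoint quasi-convex for all nonnegative weights, a
failure of midpoint convexity of the first controls the increments of the second by its second
difference. -/
lemma mul_abs_le_of_weighted_quasiconvex {c₀ c₁ c y₀ y₁ y : ℝ}
    (H : ∀ d₁ d₂ : ℝ, 0 ≤ d₁ → 0 ≤ d₂ →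
      d₁ * c + d₂ * y ≤ max (d₁ * c₀ + d₂ * y₀) (d₁ * c₁ + d₂ * y₁) ∧
      d₁ * c + d₂ * y ≤ max (d₁ * c₀ + d₂ * y₁) (d₁ * c₁ + d₂ * y₀)) :
    (2 * c - c₀ - c₁) * |y₀ - y₁| ≤ |c₁ - c₀| * (y₀ + y₁ - 2 * y) := by
  -- These weights make the two entries of one of the maxima equal; the signs decide which one. The
  -- maximum is then the average of its entries.
  obtain ⟨h1, h2⟩ := H |y₀ - y₁| |c₁ - c₀| (abs_nonneg _) (abs_nonneg _)
  rcases abs_cases (y₀ - y₁) with ⟨e, _⟩ | ⟨e, _⟩ <;>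
  rcases abs_cases (c₁ - c₀) with ⟨e', _⟩ | ⟨e', _⟩ <;>
  rw [e, e'] at h1 h2 ⊢
  · have : (y₀ - y₁) * c₀ + (c₁ - c₀) * y₀ = (y₀ - y₁) * c₁ + (c₁ - c₀) * y₁ := by ring
    rw [this, max_self] at h1
    linarith
  · have : (y₀ - y₁) * c₀ + -(c₁ - c₀) * y₁ = (y₀ - y₁) * c₁ + -(c₁ - c₀) * y₀ := by ring
    rw [this, max_self] at h2
    linarith
  · have : -(y₀ - y₁) * c₀ + (c₁ - c₀) * y₁ = -(y₀ - y₁) * c₁ + (c₁ - c₀) * y₀ := by ring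
    rw [this, max_self] at h2
    linarith
  · have : -(y₀ - y₁) * c₀ + -(c₁ - c₀) * y₀ = -(y₀ - y₁) * c₁ + -(c₁ - c₀) * y₁ := by ring
    rw [this, max_self] at h1
    linarith

/-- A continuous function is convex if all its nonnegatively weighted two-term sums are midpoint
quasi-convex on ordered pairs. -/
theorem convexOn_of_weighted_quasiconvex {h : ℝ → ℝ} (hc : ContinuousOn h (Icc 0 1))
    (Q : ∀ s₁ ∈ Icc (0 : ℝ) 1, ∀ s₂ ∈ Icc (0 : ℝ) 1, ∀ t₁ ∈ Icc (0 : ℝ) 1, ∀ t₂ ∈ Icc (0 : ℝ) 1,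
      s₂ ≤ s₁ → t₂ ≤ t₁ → ∀ d₁ d₂ : ℝ, 0 ≤ d₁ → 0 ≤ d₂ →
      d₁ * h ((s₁ + t₁) / 2) + d₂ * h ((s₂ + t₂) / 2)
        ≤ max (d₁ * h s₁ + d₂ * h s₂) (d₁ * h t₁ + d₂ * h t₂)) :
    ConvexOn ℝ (Icc (0 : ℝ) 1) h := by
  by_contra hn
  obtain ⟨p, δ₀, h0, h1, h2, h3⟩ := exists_symmetric_concave_of_not_convexOn hc hn
  -- The telescoping bound for both `κ` and `-κ` gives equality at the endpoints.
  have flat (u v κ D : ℝ) (hu : 0 ≤ u) (huv : u ≤ v) (hv : v ≤ 1) (hκ : 0 < κ)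
      (H : ∀ y ∈ Icc u v, ∀ z ∈ Icc u v,
        κ * |h y - h z| ≤ D * (h y + h z - 2 * h ((y + z) / 2))) : h u = h v := by
    have hc' := hc.mono (Icc_subset_Icc hu hv)
    have a1 := mul_sub_nonpos_of_second_difference (κ := κ) huv hc' fun y hy z hz =>
      (mul_le_mul_of_nonneg_left (le_abs_self _) hκ.le).trans (H y hy z hz)
    have a2 := mul_sub_nonpos_of_second_difference (κ := -κ) huv hc' fun y hy z hz =>
      (by rw [neg_mul, ← mul_neg]; exact mul_le_mul_of_nonneg_left (neg_le_abs _) hκ.le :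
        -κ * (h y - h z) ≤ κ * |h y - h z|).trans (H y hy z hz)
    nlinarith
  -- The pair `p ± δ` fills the first slot, with positive defect `κ`. Points of `[0, p - δ]` lie
  -- below both, so they may fill the second slot in either order. In `right` the slots are
  -- exchanged.
  have left (δ : ℝ) (d0 : 0 < δ) (d1 : δ ≤ δ₀) : h 0 = h (p - δ) := by
    refine flat 0 (p - δ) (2 * h p - h (p - δ) - h (p + δ)) |h (p + δ) - h (p - δ)| le_rfl
      (by linarith) (by linarith) (by linarith [h3 δ d0 d1]) fun y hy z hz => ?_
    have I1 : p - δ ∈ Icc (0 : ℝ) 1 := ⟨by linarith, by linarith⟩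
    have I2 : p + δ ∈ Icc (0 : ℝ) 1 := ⟨by linarith, by linarith⟩
    have I3 : y ∈ Icc (0 : ℝ) 1 := ⟨hy.1, by linarith [hy.2]⟩
    have I4 : z ∈ Icc (0 : ℝ) 1 := ⟨hz.1, by linarith [hz.2]⟩
    refine mul_abs_le_of_weighted_quasiconvex fun d₁ d₂ e₁ e₂ => ?_
    have q1 := Q _ I1 _ I3 _ I2 _ I4 hy.2 (by linarith [hz.2]) d₁ d₂ e₁ e₂
    have q2 := Q _ I1 _ I4 _ I2 _ I3 hz.2 (by linarith [hy.2]) d₁ d₂ e₁ e₂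
    rw [show (p - δ + (p + δ)) / 2 = p by ring] at q1 q2
    rw [add_comm z y] at q2
    exact ⟨q1, q2⟩
  have right (δ : ℝ) (d0 : 0 < δ) (d1 : δ ≤ δ₀) : h (p + δ) = h 1 := by
    refine flat (p + δ) 1 (2 * h p - h (p - δ) - h (p + δ)) |h (p + δ) - h (p - δ)| (by linarith)
      (by linarith) le_rfl (by linarith [h3 δ d0 d1]) fun y hy z hz => ?_
    have I1 : p - δ ∈ Icc (0 : ℝ) 1 := ⟨by linarith, by linarith⟩
    have I2 : p + δ ∈ Icc (0 : ℝ) 1 := ⟨by linarith, by linarith⟩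
    have I3 : y ∈ Icc (0 : ℝ) 1 := ⟨by linarith [hy.1], hy.2⟩
    have I4 : z ∈ Icc (0 : ℝ) 1 := ⟨by linarith [hz.1], hz.2⟩
    refine mul_abs_le_of_weighted_quasiconvex fun d₁ d₂ e₁ e₂ => ?_
    have q1 := Q _ I3 _ I1 _ I4 _ I2 (by linarith [hy.1]) hz.1 d₂ d₁ e₂ e₁
    have q2 := Q _ I4 _ I1 _ I3 _ I2 (by linarith [hz.1]) hy.1 d₂ d₁ e₂ e₁
    rw [show (p - δ + (p + δ)) / 2 = p by ring] at q1 q2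
    rw [add_comm z y] at q2
    simp only [add_comm (d₁ * _) (d₂ * _)]
    exact ⟨q1, q2⟩
  -- Letting `δ → 0` in `left` and `right` gives `h p = h 0 = h 1`; taking `δ = δ₀` then makes the
  -- second difference at `p` zero.
  have hz : Tendsto (fun N : ℕ => δ₀ * (1 / ((N : ℝ) + 1))) atTop (𝓝 0) := by
    simpa using (tendsto_one_div_add_atTop_nhds_zero_nat (𝕜 := ℝ)).const_mul δ₀
  have hb (N : ℕ) : 0 < δ₀ * (1 / ((N : ℝ) + 1)) ∧ δ₀ * (1 / ((N : ℝ) + 1)) ≤ δ₀ := by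
    refine ⟨by positivity, mul_le_of_le_one_right h0.le ?_⟩
    rw [div_le_one (by positivity)]
    linarith [(N.cast_nonneg : (0 : ℝ) ≤ N)]
  have hp : p ∈ Icc (0 : ℝ) 1 := ⟨by linarith, by linarith⟩
  have e1 : h p = h 0 := by
    refine tendsto_nhds_unique (f := fun N : ℕ => h (p - δ₀ * (1 / ((N : ℝ) + 1)))) (l := atTop)
      ((hc p hp).tendsto.comp (tendsto_nhdsWithin_iff.2 ⟨by simpa using hz.const_sub p, ?_⟩)) ?_
    · exact Eventually.of_forall fun N => ⟨by linarith [(hb N).2], by linarith [(hb N).1]⟩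
    · exact tendsto_const_nhds.congr fun N => left _ (hb N).1 (hb N).2
  have e2 : h p = h 1 := by
    refine tendsto_nhds_unique (f := fun N : ℕ => h (p + δ₀ * (1 / ((N : ℝ) + 1)))) (l := atTop)
      ((hc p hp).tendsto.comp (tendsto_nhdsWithin_iff.2 ⟨by simpa using hz.const_add p, ?_⟩)) ?_
    · exact Eventually.of_forall fun N => ⟨by linarith [(hb N).1], by linarith [(hb N).2]⟩
    · exact tendsto_const_nhds.congr fun N => (right _ (hb N).1 (hb N).2).symm
  have := h3 δ₀ h0 le_rfl
  rw [← left δ₀ h0 le_rfl, right δ₀ h0 le_rfl] at this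
  linarith

/-! ### Tail integrals and the variational formula for hinges -/

section Tails

variable {μ : Measure ℝ} [IsProbabilityMeasure μ]

lemma measurable_cdf (μ : Measure ℝ) : Measurable (cdf μ) := (monotone_cdf μ).measurable

lemma integrableOn_meas_le {α : Type*} [MeasurableSpace α] {ν : Measure α} [IsFiniteMeasure ν]
    {f : α → ℝ} (hf : Integrable f ν) (hf0 : 0 ≤ f) :
    IntegrableOn (fun t => ν.real {a | t ≤ f a}) (Ioi 0) := by
  have hanti : Antitone fun t => ν.real {a | t ≤ f a} := fun s t hst =>
    measureReal_mono fun a ha => hst.trans ha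
  refine ⟨hanti.measurable.aestronglyMeasurable, ?_⟩
  rw [hasFiniteIntegral_iff_ofReal (Eventually.of_forall fun t => measureReal_nonneg)]
  simp only [measureReal_def, ENNReal.ofReal_toReal (measure_ne_top ν _)]
  rw [← lintegral_eq_lintegral_meas_le ν (Eventually.of_forall hf0) hf.aemeasurable]
  exact hf.lintegral_lt_top

lemma integrable_max_sub (hμ : Integrable (fun x => x) μ) (y : ℝ) :
    Integrable (fun x => max (y - x) 0) μ :=
  ((integrable_const y).sub hμ).sup (integrable_const 0)

/-- Layer-cake formula for `(y - x)⁺`, followed by the reflection `t ↦ y - t`. -/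
lemma lower_tail (hμ : Integrable (fun x => x) μ) (y : ℝ) :
    IntegrableOn (cdf μ) (Iio y) ∧ ∫ x in Iio y, cdf μ x = ∫ x, max (y - x) 0 ∂μ := by
  have hf := integrable_max_sub hμ y
  have h0 : (0 : ℝ → ℝ) ≤ fun x => max (y - x) 0 := fun x => le_max_right _ _
  have e : ∀ t ∈ Ioi (0 : ℝ), μ.real {a | t ≤ max (y - a) 0} = cdf μ (y - t) := by
    intro t ht
    have ht : 0 < t := ht
    rw [cdf_eq_real]
    congr 1
    ext a
    simp only [mem_ofPred_eq, le_max_iff, not_le.2 ht, or_false, mem_Iic]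
    constructor <;> intro h <;> linarith
  have mp := Measure.measurePreserving_sub_left (volume : Measure ℝ) y
  have emb := (MeasurableEquiv.subLeft y).measurableEmbedding
  have pre : (fun t => y - t) ⁻¹' Iio y = Ioi 0 := by ext t; simp
  constructor
  · rw [← mp.integrableOn_comp_preimage emb, pre]
    exact (integrableOn_meas_le hf h0).congr_fun e measurableSet_Ioi
  · rw [hf.integral_eq_integral_meas_le (Eventually.of_forall h0),
      setIntegral_congr_fun measurableSet_Ioi e, ← pre,
      mp.setIntegral_preimage_emb emb (cdf μ) (Iio y)]

lemma upper_tail (hμ : Integrable (fun x => x) μ) :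
    IntegrableOn (fun x => 1 - cdf μ x) (Ioi 0) ∧
      ∫ x in Ioi 0, (1 - cdf μ x) = ∫ x, max x 0 ∂μ := by
  have hf : Integrable (fun x => max x 0) μ := hμ.sup (integrable_const 0)
  have h0 : (0 : ℝ → ℝ) ≤ fun x => max x 0 := fun x => le_max_right _ _
  have e : ∀ t ∈ Ioi (0 : ℝ), μ.real {a | t < max a 0} = 1 - cdf μ t := by
    intro t ht
    have ht : 0 < t := ht
    rw [cdf_eq_real, ← probReal_compl_eq_one_sub measurableSet_Iic]
    congr 1
    ext a
    simp [not_lt.2 ht.le]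
  -- Strict and weak superlevel sets differ in measure only on a null set of levels.
  have e' : ∀ᵐ t ∂(volume.restrict (Ioi (0 : ℝ))),
      μ.real {a | t ≤ max a 0} = 1 - cdf μ t := by
    filter_upwards [meas_le_ae_eq_meas_lt μ (volume.restrict (Ioi (0 : ℝ))) fun a => max a 0,
      ae_restrict_mem measurableSet_Ioi] with t h1 h2
    rw [← e t h2]
    exact congrArg ENNReal.toReal h1
  constructor
  · exact (integrableOn_meas_le hf h0).congr_fun_ae e'
  · rw [hf.integral_eq_integral_meas_lt (Eventually.of_forall h0),
      setIntegral_congr_fun measurableSet_Ioi e]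

/-- The survival function minus that of the point mass at `0`. -/
lemma integrable_survival_sub (hμ : Integrable (fun x => x) μ) :
    Integrable fun x => (1 - cdf μ x) - (Iio (0 : ℝ)).indicator (fun _ => 1) x := by
  rw [← integrableOn_univ, ← Iio_union_Ici (a := (0 : ℝ)), integrableOn_union]
  constructor
  · refine (lower_tail hμ 0).1.neg.congr_fun (fun x hx => ?_) measurableSet_Iio
    rw [indicator_of_mem hx]
    simp only [Pi.neg_apply]; ring
  · rw [integrableOn_Ici_iff_integrableOn_Ioi]
    refine (upper_tail hμ).1.congr_fun (fun x hx => ?_) measurableSet_Ioi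
    rw [indicator_of_notMem (by simpa using (le_of_lt hx))]
    ring

/-- Merging the two half-lines into one integral allows integrands to be split at a level `y` of
either sign. -/
lemma hasFiniteChoquet_iff {h : ℝ → ℝ} {μ : Measure ℝ} : HasFiniteChoquet h μ ↔
    Integrable fun x => h (1 - cdf μ x) - (Iio (0 : ℝ)).indicator (fun _ => h 1) x := by
  rw [← integrableOn_univ, ← Iio_union_Ici (a := (0 : ℝ)), integrableOn_union,
    integrableOn_Ici_iff_integrableOn_Ioi, HasFiniteChoquet, and_comm]
  refine and_congr (integrableOn_congr_fun (fun x hx => ?_) measurableSet_Iio)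
    (integrableOn_congr_fun (fun x hx => ?_) measurableSet_Ioi)
  · rw [indicator_of_mem hx]
  · rw [indicator_of_notMem (by simpa using (le_of_lt hx))]
    ring

lemma choquet_eq_integral {h : ℝ → ℝ} {μ : Measure ℝ} (hfin : HasFiniteChoquet h μ) :
    choquet h μ =
      ∫ x, (h (1 - cdf μ x) - (Iio (0 : ℝ)).indicator (fun _ => h 1) x) := by
  have hi := hasFiniteChoquet_iff.1 hfin
  rw [← integral_add_compl (measurableSet_Ioi (a := (0 : ℝ))) hi, compl_Ioi,
    integral_Iic_eq_integral_Iio, choquet]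
  congr 1
  · refine setIntegral_congr_fun measurableSet_Ioi fun x hx => ?_
    rw [indicator_of_notMem (by simpa using (le_of_lt hx))]
    ring
  · refine setIntegral_congr_fun measurableSet_Iio fun x hx => ?_
    rw [indicator_of_mem hx]

lemma hasFiniteChoquet_id (hμ : Integrable (fun x => x) μ) : HasFiniteChoquet (fun s => s) μ :=
  hasFiniteChoquet_iff.2 (integrable_survival_sub hμ)

lemma choquet_id (hμ : Integrable (fun x => x) μ) : choquet (fun s => s) μ = ∫ x, x ∂μ := by
  have e : ∫ x in Iio (0 : ℝ), (1 - cdf μ x - 1) = -∫ x in Iio (0 : ℝ), cdf μ x := by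
    rw [← integral_neg]; congr 1; ext x; ring
  have hf : Integrable (fun x => max x 0) μ := hμ.sup (integrable_const 0)
  rw [choquet, e, (upper_tail hμ).2, (lower_tail hμ 0).2, ← sub_eq_add_neg,
    ← integral_sub hf (integrable_max_sub hμ 0)]
  congr 1
  ext x
  rcases le_total x 0 with h | h
  · rw [max_eq_right h, max_eq_left (by linarith)]; ring
  · rw [max_eq_left h, max_eq_right (by linarith)]; ring

/-- The distortion function `s ↦ (s - k)⁺`. -/
def hinge (k s : ℝ) : ℝ := max (s - k) 0

lemma continuous_hinge (k : ℝ) : Continuous (hinge k) :=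
  (continuous_id.sub continuous_const).max continuous_const

lemma hasFiniteChoquet_hinge (hμ : Integrable (fun x => x) μ) {k : ℝ} (h0 : 0 ≤ k) (h1 : k ≤ 1) :
    HasFiniteChoquet (hinge k) μ := by
  -- The hinge is 1-Lipschitz, so its integrand is dominated by that of the identity distortion.
  refine hasFiniteChoquet_iff.2 ((integrable_survival_sub hμ).mono ?_ ?_)
  · exact (((continuous_hinge k).measurable.comp (measurable_const.sub (measurable_cdf μ))).sub
      (measurable_const.indicator measurableSet_Iio)).aestronglyMeasurable
  · refine Eventually.of_forall fun x => ?_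
    have c0 := cdf_nonneg μ x
    have c1 := cdf_le_one μ x
    have m1 : hinge k 1 = 1 - k := max_eq_left (by linarith)
    rw [Real.norm_eq_abs, Real.norm_eq_abs]
    by_cases hx : x ∈ Iio (0 : ℝ)
    · rw [indicator_of_mem hx, indicator_of_mem hx, m1, abs_of_nonpos, abs_of_nonpos]
      · have : 1 - cdf μ x - k ≤ hinge k (1 - cdf μ x) := le_max_left _ _
        linarith
      · linarith
      · have : hinge k (1 - cdf μ x) ≤ 1 - k := max_le (by linarith) (by linarith)
        linarith
    · rw [indicator_of_notMem hx, indicator_of_notMem hx, sub_zero, sub_zero, abs_of_nonneg,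
        abs_of_nonneg (by linarith)]
      · exact max_le (by linarith) (by linarith)
      · exact le_max_right _ _

/-- With `S` the survival function, this is the hinge integrand with `(S - k)⁺` replaced by `(S - k)
1_{x < y}`, so comparing integrands compares the hinge functional with its variational expression at
`y`. -/
lemma lower_partial_moment_eq_integral (hμ : Integrable (fun x => x) μ) (k y : ℝ) :
    Integrable (fun x => (Iio y).indicator (fun x => 1 - cdf μ x - k) x
        - (Iio (0 : ℝ)).indicator (fun _ => 1 - k) x) ∧
      ∫ x, ((Iio y).indicator (fun x => 1 - cdf μ x - k) x
        - (Iio (0 : ℝ)).indicator (fun _ => 1 - k) x) =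
      (1 - k) * y - ∫ x, max (y - x) 0 ∂μ := by
  have i1 (a b c : ℝ) : Integrable ((Ico a b).indicator fun _ => c) :=
    (integrable_indicator_iff measurableSet_Ico).2 (integrableOn_const (by simp))
  have e : (fun x => (Iio y).indicator (fun x => 1 - cdf μ x - k) x
        - (Iio (0 : ℝ)).indicator (fun _ => 1 - k) x) =
      fun x => ((Ico 0 y).indicator (fun _ => 1 - k) x - (Ico y 0).indicator (fun _ => 1 - k) x)
        - (Iio y).indicator (cdf μ) x := by
    -- At most one of `Ico 0 y` and `Ico y 0` is nonempty; their difference is the signed interval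
    -- from `0` to `y`.
    funext x
    rcases lt_or_ge x y with h1 | h1 <;> rcases lt_or_ge x 0 with h2 | h2 <;>
      simp [indicator, h1, h2, not_lt.2, not_le.2]; ring
  obtain ⟨l1, l2⟩ := lower_tail hμ y
  have l1' : Integrable ((Iio y).indicator (cdf μ)) :=
    (integrable_indicator_iff measurableSet_Iio).2 l1
  have i2 := (i1 0 y (1 - k)).sub (i1 y 0 (1 - k))
  rw [e]
  refine ⟨i2.sub l1', ?_⟩
  have a1 := integral_sub i2 l1'
  have a2 := integral_sub (i1 0 y (1 - k)) (i1 y 0 (1 - k))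
  simp only [Pi.sub_apply] at a1
  rw [a1, a2, integral_indicator measurableSet_Iio, l2,
    integral_indicator_const _ measurableSet_Ico, integral_indicator_const _ measurableSet_Ico]
  congr 1
  rcases le_total 0 y with h | h
  · simp [h, mul_comm]
  · simp [h, mul_comm]

lemma le_choquet_hinge (hμ : Integrable (fun x => x) μ) {k : ℝ} (h0 : 0 ≤ k) (h1 : k ≤ 1) (y : ℝ) :
    (1 - k) * y - ∫ x, max (y - x) 0 ∂μ ≤ choquet (hinge k) μ := by
  have hf := hasFiniteChoquet_hinge hμ h0 h1
  obtain ⟨i1, e1⟩ := lower_partial_moment_eq_integral hμ k y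
  rw [choquet_eq_integral hf, ← e1]
  refine integral_mono i1 (hasFiniteChoquet_iff.1 hf) fun x => ?_
  have m1 : hinge k 1 = 1 - k := max_eq_left (by linarith)
  simp only [m1]
  refine sub_le_sub_right ?_ _
  by_cases hx : x ∈ Iio y
  · rw [indicator_of_mem hx]; exact le_max_left _ _
  · rw [indicator_of_notMem hx]; exact le_max_right _ _

lemma exists_quantile (μ : Measure ℝ) {p : ℝ} (h0 : 0 < p) (h1 : p < 1) :
    ∃ y, (∀ x < y, cdf μ x ≤ p) ∧ ∀ x, y < x → p ≤ cdf μ x := by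
  have ne : {x | p ≤ cdf μ x}.Nonempty :=
    ((tendsto_cdf_atTop μ).eventually (eventually_ge_nhds h1)).exists
  have bdd : BddBelow {x | p ≤ cdf μ x} := by
    obtain ⟨b, hb⟩ := ((tendsto_cdf_atBot μ).eventually (eventually_lt_nhds h0)).exists
    refine ⟨b, fun x hx => ?_⟩
    by_contra hlt
    have hx : p ≤ cdf μ x := hx
    have := monotone_cdf μ (not_le.1 hlt).le
    linarith
  refine ⟨sInf {x | p ≤ cdf μ x}, fun x hx => ?_, fun x hx => ?_⟩
  · exact (not_le.1 fun h : p ≤ cdf μ x => notMem_of_lt_csInf hx bdd h).le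
  · obtain ⟨z, hz, hzx⟩ := exists_lt_of_csInf_lt ne hx
    exact (show p ≤ cdf μ z from hz).trans (monotone_cdf μ hzx.le)

/-- The maximum is attained at a `(1 - k)`-quantile: the survival function is at least `k` before it
and at most `k` after it, so the two integrands agree off one point. -/
lemma exists_choquet_hinge_eq (hμ : Integrable (fun x => x) μ) {k : ℝ} (h0 : 0 < k) (h1 : k < 1) :
    ∃ y, choquet (hinge k) μ = (1 - k) * y - ∫ x, max (y - x) 0 ∂μ := by
  obtain ⟨y, hy, hy'⟩ := exists_quantile μ (p := 1 - k) (by linarith) (by linarith)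
  refine ⟨y, ?_⟩
  have hf := hasFiniteChoquet_hinge hμ h0.le h1.le
  obtain ⟨-, e1⟩ := lower_partial_moment_eq_integral hμ k y
  rw [choquet_eq_integral hf, ← e1]
  have m1 : hinge k 1 = 1 - k := max_eq_left (by linarith)
  refine integral_congr_ae ?_
  have hne : ∀ᵐ x : ℝ, x ≠ y := by simp [ae_iff]
  filter_upwards [hne] with x hx
  rw [m1]
  congr 1
  rcases lt_or_gt_of_ne hx with h | h
  · rw [indicator_of_mem (show x ∈ Iio y from h)]
    exact max_eq_left (by linarith [hy x h])
  · rw [indicator_of_notMem (show x ∉ Iio y from not_lt.2 h.le)]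
    exact max_eq_right (by linarith [hy' x h])

end Tails

/-! ### Linearity of the Choquet integral in the distortion -/

section Linearity

variable {μ : Measure ℝ} {g h : ℝ → ℝ}

lemma HasFiniteChoquet.add (hg : HasFiniteChoquet g μ) (hh : HasFiniteChoquet h μ) :
    HasFiniteChoquet (fun s => g s + h s) μ :=
  ⟨hg.1.add hh.1, (hg.2.add hh.2).congr (Eventually.of_forall fun x => by
    simp only [Pi.add_apply]; ring)⟩

lemma choquet_add (hg : HasFiniteChoquet g μ) (hh : HasFiniteChoquet h μ) :
    choquet (fun s => g s + h s) μ = choquet g μ + choquet h μ := by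
  have e : ∫ x in Iio (0 : ℝ), (g (1 - cdf μ x) + h (1 - cdf μ x) - (g 1 + h 1)) =
      ∫ x in Iio (0 : ℝ), ((g (1 - cdf μ x) - g 1) + (h (1 - cdf μ x) - h 1)) := by
    congr 1; ext x; ring
  simp only [choquet]
  rw [e, integral_add hg.1 hh.1, integral_add hg.2 hh.2]
  ring

lemma HasFiniteChoquet.const_mul (hh : HasFiniteChoquet h μ) (c : ℝ) :
    HasFiniteChoquet (fun s => c * h s) μ :=
  ⟨hh.1.const_mul c, (hh.2.const_mul c).congr (Eventually.of_forall fun x => by ring)⟩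

lemma choquet_const_mul (c : ℝ) : choquet (fun s => c * h s) μ = c * choquet h μ := by
  simp only [choquet, ← mul_sub, integral_const_mul]
  ring

lemma choquet_sum (c : ℕ → ℝ) (f : ℕ → ℝ → ℝ) (n : ℕ) (hf : ∀ i < n, HasFiniteChoquet (f i) μ) :
    HasFiniteChoquet (fun s => ∑ i ∈ Finset.range n, c i * f i s) μ ∧
      choquet (fun s => ∑ i ∈ Finset.range n, c i * f i s) μ =
        ∑ i ∈ Finset.range n, c i * choquet (f i) μ := by
  induction n with
  | zero => simp [HasFiniteChoquet, choquet]
  | succ n ih =>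
    obtain ⟨i1, i2⟩ := ih fun i hi => hf i (by omega)
    have i3 := (hf n (by omega)).const_mul (c n)
    simp only [Finset.sum_range_succ]
    exact ⟨i1.add i3, by rw [choquet_add i1 i3, i2, choquet_const_mul]⟩

end Linearity

/-! ### Approximation of convex distortions by sums of hinges -/

section Interpolation

/-- The piecewise linear interpolation of `h` at the nodes `j / (n + 1)`, for `h 0 = 0`. -/
noncomputable def interp (h : ℝ → ℝ) (n : ℕ) (s : ℝ) : ℝ :=
  (n + 1) * h (1 / (n + 1)) * s + ∑ i ∈ Finset.range n,
    (n + 1) * (h ((i + 2) / (n + 1)) - 2 * h ((i + 1) / (n + 1)) + h (i / (n + 1))) *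
      hinge ((i + 1) / (n + 1)) s

/-- Each second difference is the change of slope at a node, so the sum up to `m` produces the line
through the data at `m` and `m + 1`. -/
lemma sum_second_difference_mul (f : ℕ → ℝ) (m : ℕ) (y : ℝ) :
    f 0 + (f 1 - f 0) * y
        + ∑ i ∈ Finset.range m, (f (i + 2) - 2 * f (i + 1) + f i) * (y - (i + 1)) =
      f m + (f (m + 1) - f m) * (y - m) := by
  induction m with
  | zero => simp
  | succ m ih =>
    rw [Finset.sum_range_succ, ← add_assoc, ih]
    push_cast
    ring

lemma interp_eq {h : ℝ → ℝ} (h0 : h 0 = 0) {n j : ℕ} (hj : j ≤ n) {s t : ℝ} (ht0 : 0 ≤ t)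
    (ht1 : t ≤ 1) (hs : s = (j + t) / (n + 1)) :
    interp h n s = (1 - t) * h (j / (n + 1)) + t * h ((j + 1) / (n + 1)) := by
  have hN : (0 : ℝ) < n + 1 := by positivity
  set f : ℕ → ℝ := fun i => h (i / (n + 1)) with hf
  have key := sum_second_difference_mul f j (j + t)
  have f0 : f 0 = 0 := by simp [hf, h0]
  have hsub : Finset.range j ⊆ Finset.range n := Finset.range_subset_range.2 hj
  have e : ∑ i ∈ Finset.range n,
      (n + 1) * (h ((i + 2) / (n + 1)) - 2 * h ((i + 1) / (n + 1)) + h (i / (n + 1))) *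
        hinge ((i + 1) / (n + 1)) s =
      ∑ i ∈ Finset.range j, (f (i + 2) - 2 * f (i + 1) + f i) * ((j : ℝ) + t - (i + 1)) := by
    -- On cell `j` only the hinges with nodes `(i + 1) / (n + 1)`, `i < j`, can be nonzero.
    rw [← Finset.sum_subset hsub]
    · refine Finset.sum_congr rfl fun i hi => ?_
      have hi : (i : ℝ) + 1 ≤ j := by exact_mod_cast Finset.mem_range.1 hi
      have : hinge ((i + 1) / (n + 1)) s = (j + t - (i + 1)) / (n + 1) := by
        rw [hinge, hs, ← sub_div, max_eq_left (div_nonneg (by linarith) hN.le)]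
      rw [this]
      simp only [hf]
      push_cast
      field_simp
    · intro i _ hi
      have hi : (j : ℝ) ≤ i := by exact_mod_cast not_lt.1 fun h => hi (Finset.mem_range.2 h)
      have : hinge ((i + 1) / (n + 1)) s = 0 := by
        rw [hinge, hs, ← sub_div, max_eq_right (div_nonpos_of_nonpos_of_nonneg (by linarith) hN.le)]
      rw [this, mul_zero]
  rw [interp, e]
  have e1 : ((n : ℝ) + 1) * h (1 / (n + 1)) * s = (f 1 - f 0) * (j + t) := by
    rw [f0, hs]; simp only [hf]; push_cast; field_simp; ring
  have e2 : h ((j + 1) / (n + 1)) = f (j + 1) := by simp only [hf]; push_cast; rfl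
  rw [e1, e2]
  have e3 : h (j / (n + 1)) = f j := rfl
  rw [e3]
  linarith [key, f0]

lemma exists_cell (n : ℕ) {s : ℝ} (hs : s ∈ Icc (0 : ℝ) 1) :
    ∃ j ≤ n, ∃ t : ℝ, 0 ≤ t ∧ t ≤ 1 ∧ s = (j + t) / (n + 1) := by
  have hN : (0 : ℝ) < n + 1 := by positivity
  -- At `s = 1` the floor would be `n + 1`, one past the last cell.
  rcases hs.2.eq_or_lt with h1 | h1
  · exact ⟨n, le_rfl, 1, zero_le_one, le_rfl, by rw [h1, div_self hN.ne']⟩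
  · have h0 : 0 ≤ s * (n + 1) := mul_nonneg hs.1 hN.le
    have fl := Nat.floor_le h0
    have lf := Nat.lt_floor_add_one (s * (n + 1))
    refine ⟨⌊s * (n + 1)⌋₊, ?_, s * (n + 1) - ⌊s * (n + 1)⌋₊, by linarith, by linarith, ?_⟩
    · have : ((⌊s * (n + 1)⌋₊ : ℕ) : ℝ) < ((n + 1 : ℕ) : ℝ) := by
        push_cast; nlinarith
      exact Nat.lt_succ_iff.1 (by exact_mod_cast this)
    · rw [add_sub_cancel, mul_div_cancel_right₀ _ hN.ne']

variable {h : ℝ → ℝ}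

lemma node_mem {n j : ℕ} (hj : j ≤ n + 1) : (j / (n + 1) : ℝ) ∈ Icc (0 : ℝ) 1 := by
  have hN : (0 : ℝ) < n + 1 := by positivity
  refine ⟨by positivity, (div_le_one hN).2 ?_⟩
  exact_mod_cast hj

lemma node_succ_mem {n j : ℕ} (hj : j ≤ n) : ((j + 1) / (n + 1) : ℝ) ∈ Icc (0 : ℝ) 1 := by
  simpa using node_mem (n := n) (j := j + 1) (by omega)

lemma le_interp (hcv : ConvexOn ℝ (Icc (0 : ℝ) 1) h) (h0 : h 0 = 0) (n : ℕ) {s : ℝ}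
    (hs : s ∈ Icc (0 : ℝ) 1) : h s ≤ interp h n s := by
  obtain ⟨j, hj, t, ht0, ht1, e⟩ := exists_cell n hs
  rw [interp_eq h0 hj ht0 ht1 e]
  have := hcv.2 (node_mem (n := n) (by omega : j ≤ n + 1)) (node_succ_mem hj)
    (by linarith : 0 ≤ 1 - t) ht0 (by ring)
  simp only [smul_eq_mul] at this
  rwa [show (1 - t) * ((j : ℝ) / (n + 1)) + t * ((j + 1) / (n + 1)) = s by rw [e]; ring] at this

lemma le_chord (hcv : ConvexOn ℝ (Icc (0 : ℝ) 1) h) (h0 : h 0 = 0) {s : ℝ}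
    (hs : s ∈ Icc (0 : ℝ) 1) : h s ≤ h 1 * s := by
  have := hcv.2 (left_mem_Icc.2 zero_le_one) (right_mem_Icc.2 zero_le_one)
    (by linarith [hs.2] : 0 ≤ 1 - s) hs.1 (by ring)
  simp only [smul_eq_mul, mul_zero, mul_one, zero_add, h0] at this
  linarith

/-- With `le_interp` this encloses every interpolant between `h` and the chord `h 1 * s`, which
yields an integrable bound independent of `n`. -/
lemma interp_le_chord (hcv : ConvexOn ℝ (Icc (0 : ℝ) 1) h) (h0 : h 0 = 0) (n : ℕ) {s : ℝ}
    (hs : s ∈ Icc (0 : ℝ) 1) : interp h n s ≤ h 1 * s := by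
  obtain ⟨j, hj, t, ht0, ht1, e⟩ := exists_cell n hs
  rw [interp_eq h0 hj ht0 ht1 e]
  have a1 := le_chord hcv h0 (node_mem (n := n) (by omega : j ≤ n + 1))
  have a2 := le_chord hcv h0 (node_succ_mem hj)
  calc _ ≤ (1 - t) * (h 1 * (j / (n + 1))) + t * (h 1 * ((j + 1) / (n + 1))) :=
        add_le_add (mul_le_mul_of_nonneg_left a1 (by linarith))
          (mul_le_mul_of_nonneg_left a2 ht0)
    _ = h 1 * s := by rw [e]; ring

lemma interp_one (hcv : ConvexOn ℝ (Icc (0 : ℝ) 1) h) (h0 : h 0 = 0) (n : ℕ) :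
    interp h n 1 = h 1 :=
  le_antisymm (by simpa using interp_le_chord hcv h0 n (right_mem_Icc.2 zero_le_one))
    (le_interp hcv h0 n (right_mem_Icc.2 zero_le_one))

lemma tendsto_interp (hc : ContinuousOn h (Icc 0 1)) (h0 : h 0 = 0) {s : ℝ}
    (hs : s ∈ Icc (0 : ℝ) 1) : Tendsto (fun n => interp h n s) atTop (𝓝 (h s)) := by
  rw [Metric.tendsto_atTop]
  intro ε hε
  obtain ⟨δ, hδ, H⟩ := Metric.continuousOn_iff.1 hc s hs ε hε
  obtain ⟨M, hM⟩ := exists_nat_one_div_lt hδ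
  refine ⟨M, fun n hn => ?_⟩
  obtain ⟨j, hj, t, ht0, ht1, e⟩ := exists_cell n hs
  have hN : (0 : ℝ) < n + 1 := by positivity
  have hnM : 1 / ((n : ℝ) + 1) < δ := (one_div_le_one_div_of_le (by positivity)
    (by exact_mod_cast Nat.succ_le_succ hn)).trans_lt hM
  have b1 := H _ (node_mem (n := n) (by omega : j ≤ n + 1)) (by
    rw [Real.dist_eq, e, ← sub_div, abs_div, abs_of_pos hN]
    refine lt_of_le_of_lt ?_ hnM
    gcongr
    rw [abs_le]; constructor <;> linarith)
  have b2 := H _ (node_succ_mem hj) (by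
    rw [Real.dist_eq, e, ← sub_div, abs_div, abs_of_pos hN]
    refine lt_of_le_of_lt ?_ hnM
    gcongr
    rw [abs_le]; constructor <;> linarith)
  rw [interp_eq h0 hj ht0 ht1 e]
  have hb := (convex_ball (h s) ε) (Metric.mem_ball.2 b1) (Metric.mem_ball.2 b2)
    (by linarith : 0 ≤ 1 - t) ht0 (by ring)
  simpa using hb

lemma interp_coeff_nonneg (hcv : ConvexOn ℝ (Icc (0 : ℝ) 1) h) {n i : ℕ} (hi : i < n) :
    0 ≤ ((n : ℝ) + 1) *
      (h ((i + 2) / (n + 1)) - 2 * h ((i + 1) / (n + 1)) + h (i / (n + 1))) := by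
  have m1 := node_mem (n := n) (by omega : i ≤ n + 1)
  have m2 := node_mem (n := n) (by omega : i + 2 ≤ n + 1)
  have := hcv.2 m1 m2 (by norm_num : (0 : ℝ) ≤ 1 / 2) (by norm_num : (0 : ℝ) ≤ 1 / 2) (by norm_num)
  simp only [smul_eq_mul] at this
  push_cast at this
  rw [show (1 / 2 * (i / (n + 1)) + 1 / 2 * ((i + 2) / (n + 1)) : ℝ) = (i + 1) / (n + 1) by ring]
    at this
  exact mul_nonneg (by positivity) (by linarith)

lemma node_interior {n i : ℕ} (hi : i < n) :
    0 < ((i + 1) / (n + 1) : ℝ) ∧ ((i + 1) / (n + 1) : ℝ) < 1 := by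
  refine ⟨by positivity, (div_lt_one (by positivity)).2 ?_⟩
  have : (i : ℝ) < n := by exact_mod_cast hi
  linarith

variable {μ : Measure ℝ} [IsProbabilityMeasure μ]

lemma choquet_interp (hμ : Integrable (fun x => x) μ) (n : ℕ) :
    HasFiniteChoquet (interp h n) μ ∧ choquet (interp h n) μ =
      (n + 1) * h (1 / (n + 1)) * ∫ x, x ∂μ + ∑ i ∈ Finset.range n,
        (n + 1) * (h ((i + 2) / (n + 1)) - 2 * h ((i + 1) / (n + 1)) + h (i / (n + 1))) *
          choquet (hinge ((i + 1) / (n + 1))) μ := by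
  obtain ⟨i1, e1⟩ := choquet_sum (μ := μ)
    (fun i => (n + 1) * (h ((i + 2) / (n + 1)) - 2 * h ((i + 1) / (n + 1)) + h (i / (n + 1))))
    (fun i => hinge ((i + 1) / (n + 1))) n fun i hi =>
      hasFiniteChoquet_hinge hμ (node_interior hi).1.le (node_interior hi).2.le
  have i2 := (hasFiniteChoquet_id hμ).const_mul ((n + 1) * h (1 / (n + 1)))
  refine ⟨i2.add i1, ?_⟩
  have := choquet_add i2 i1
  rw [e1, choquet_const_mul, choquet_id hμ] at this
  exact this

lemma tendsto_choquet_interp (hcv : ConvexOn ℝ (Icc (0 : ℝ) 1) h)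
    (hc : ContinuousOn h (Icc 0 1)) (h0 : h 0 = 0) (hμ : Integrable (fun x => x) μ)
    (hf : HasFiniteChoquet h μ) :
    Tendsto (fun n => choquet (interp h n) μ) atTop (𝓝 (choquet h μ)) := by
  have hS (x : ℝ) : 1 - cdf μ x ∈ Icc (0 : ℝ) 1 :=
    ⟨by linarith [cdf_le_one μ x], by linarith [cdf_nonneg μ x]⟩
  have hi := (hasFiniteChoquet_id hμ).const_mul (h 1)
  refine Tendsto.add ?_ ?_
  · refine tendsto_integral_of_dominated_convergence
      (fun x => |h (1 - cdf μ x)| + |h 1 * (1 - cdf μ x)|)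
      (fun n => (choquet_interp hμ n).1.1.aestronglyMeasurable) (hf.1.abs.add hi.1.abs)
      (fun n => Eventually.of_forall fun x => ?_)
      (Eventually.of_forall fun x => tendsto_interp hc h0 (hS x))
    have l1 := le_interp hcv h0 n (hS x)
    have l2 := interp_le_chord hcv h0 n (hS x)
    rw [Real.norm_eq_abs, abs_le]
    constructor
    · linarith [neg_abs_le (h (1 - cdf μ x)), abs_nonneg (h 1 * (1 - cdf μ x))]
    · linarith [le_abs_self (h 1 * (1 - cdf μ x)), abs_nonneg (h (1 - cdf μ x))]
  · refine tendsto_integral_of_dominated_convergence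
      (fun x => |h (1 - cdf μ x) - h 1| + |h 1 * (1 - cdf μ x) - h 1 * 1|)
      (fun n => (choquet_interp hμ n).1.2.aestronglyMeasurable) (hf.2.abs.add hi.2.abs)
      (fun n => Eventually.of_forall fun x => ?_)
      (Eventually.of_forall fun x => ?_)
    · have l1 := le_interp hcv h0 n (hS x)
      have l2 := interp_le_chord hcv h0 n (hS x)
      rw [interp_one hcv h0, Real.norm_eq_abs, abs_le]
      constructor
      · linarith [neg_abs_le (h (1 - cdf μ x) - h 1), abs_nonneg (h 1 * (1 - cdf μ x) - h 1 * 1)]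
      · linarith [le_abs_self (h 1 * (1 - cdf μ x) - h 1 * 1), abs_nonneg (h (1 - cdf μ x) - h 1)]
    · simp only [interp_one hcv h0]
      exact (tendsto_interp hc h0 (hS x)).sub_const _

end Interpolation

/-! ### Consequences of convexity of the distortion -/

section ConvexDistortion

variable {h : ℝ → ℝ}

lemma choquet_hinge_le_of_concaveOrderLE {μ ν : Measure ℝ} [IsProbabilityMeasure μ]
    [IsProbabilityMeasure ν] (hμ : Integrable (fun x => x) μ) (hν : Integrable (fun x => x) ν)
    (hle : ConcaveOrderLE μ ν) {k : ℝ} (h0 : 0 < k) (h1 : k < 1) :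
    choquet (hinge k) μ ≤ choquet (hinge k) ν := by
  -- The level `y` optimal for `μ` is a competitor for `ν`, and `x ↦ -(y - x)⁺` is concave.
  obtain ⟨y, hy⟩ := exists_choquet_hinge_eq hμ h0 h1
  have hcv : ConvexOn ℝ univ fun x : ℝ => max (y - x) 0 :=
    ((convexOn_const y convex_univ).sub (concaveOn_id convex_univ)).sup
      (convexOn_const 0 convex_univ)
  have := (hle _ hcv.neg (integrable_max_sub hμ y).neg).2
  simp only [Pi.neg_apply, integral_neg] at this
  have := le_choquet_hinge hν h0.le h1.le y
  linarith

theorem choquet_le_of_concaveOrderLE (hcv : ConvexOn ℝ (Icc (0 : ℝ) 1) h)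
    (hc : ContinuousOn h (Icc 0 1)) (h0 : h 0 = 0) {μ ν : Measure ℝ} [IsProbabilityMeasure μ]
    [IsProbabilityMeasure ν] (hμ : Integrable (fun x => x) μ) (hν : Integrable (fun x => x) ν)
    (hfμ : HasFiniteChoquet h μ) (hfν : HasFiniteChoquet h ν) (hle : ConcaveOrderLE μ ν) :
    choquet h μ ≤ choquet h ν := by
  -- Both `x` and `-x` are concave, so the order fixes the mean. This handles the linear term of the
  -- interpolant, whose coefficient may have either sign.
  have m : ∫ x, x ∂μ = ∫ x, x ∂ν := by
    have a1 := (hle _ (concaveOn_id convex_univ) hμ).2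
    have a2 := (hle _ (convexOn_id convex_univ).neg hμ.neg).2
    simp only [Pi.neg_apply, id] at a1 a2
    rw [integral_neg, integral_neg] at a2
    linarith
  refine le_of_tendsto_of_tendsto' (tendsto_choquet_interp hcv hc h0 hμ hfμ)
    (tendsto_choquet_interp hcv hc h0 hν hfν) fun n => ?_
  rw [(choquet_interp hμ n).2, (choquet_interp hν n).2, m]
  refine add_le_add le_rfl (Finset.sum_le_sum fun i hi => ?_)
  have hi := Finset.mem_range.1 hi
  exact mul_le_mul_of_nonneg_left (choquet_hinge_le_of_concaveOrderLE hμ hν hle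
    (node_interior hi).1 (node_interior hi).2) (interp_coeff_nonneg hcv hi)

variable {Ω : Type*} [MeasurableSpace Ω] {P : Measure Ω} {q : ℝ≥0∞}

lemma law_smul_add_smul (a b : ℝ) (X Y : Lp ℝ q P) :
    law (a • X + b • Y) = P.map fun ω => a * X ω + b * Y ω := by
  refine Measure.map_congr ?_
  filter_upwards [Lp.coeFn_add (a • X) (b • Y), Lp.coeFn_smul a X, Lp.coeFn_smul b Y]
    with ω h1 h2 h3
  rw [h1, Pi.add_apply, h2, h3]
  rfl

variable [IsProbabilityMeasure P]

lemma integrable_law (hq : 1 ≤ q) (X : Lp ℝ q P) : Integrable (fun x => x) (law X) := by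
  refine (integrable_map_measure aestronglyMeasurable_id (aemeasurable_Lp X)).2 ?_
  exact (Lp.memLp X).integrable hq

lemma integral_law_smul_add_smul (hq : 1 ≤ q) (a b : ℝ) (X Y : Lp ℝ q P) :
    ∫ x, x ∂(law (a • X + b • Y)) = a * ∫ x, x ∂(law X) + b * ∫ x, x ∂(law Y) := by
  have hX := aemeasurable_Lp X
  have hY := aemeasurable_Lp Y
  have iX := (Lp.memLp X).integrable hq
  have iY := (Lp.memLp Y).integrable hq
  have hZ : AEMeasurable (fun ω => a * X ω + b * Y ω) P := (hX.const_mul a).add (hY.const_mul b)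
  have im {Z : Ω → ℝ} (hZ : AEMeasurable Z P) : ∫ x, x ∂(P.map Z) = ∫ ω, Z ω ∂P :=
    integral_map hZ aestronglyMeasurable_id
  rw [law_smul_add_smul, law, law, im hZ, im hX, im hY,
    integral_add (iX.const_mul a) (iY.const_mul b), integral_const_mul, integral_const_mul]

lemma choquet_hinge_superlinear (hq : 1 ≤ q) {a b : ℝ} (ha : 0 ≤ a) (hb : 0 ≤ b)
    (X Y : Lp ℝ q P) {k : ℝ} (h0 : 0 < k) (h1 : k < 1) :
    a * choquet (hinge k) (law X) + b * choquet (hinge k) (law Y)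
      ≤ choquet (hinge k) (law (a • X + b • Y)) := by
  obtain ⟨y, hy⟩ := exists_choquet_hinge_eq (integrable_law hq X) h0 h1
  obtain ⟨z, hz⟩ := exists_choquet_hinge_eq (integrable_law hq Y) h0 h1
  -- The combination `a * y + b * z` of the optimal levels is a competitor for `a X + b Y`;
  -- sublinearity of the positive part does the rest.
  refine le_trans ?_ (le_choquet_hinge (integrable_law hq (a • X + b • Y)) h0.le h1.le
    (a * y + b * z))
  have hX := aemeasurable_Lp X
  have hY := aemeasurable_Lp Y
  have iX := (Lp.memLp X).integrable hq
  have iY := (Lp.memLp Y).integrable hq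
  have sm (c : ℝ) (ν : Measure ℝ) : AEStronglyMeasurable (fun x : ℝ => max (c - x) 0) ν :=
    ((continuous_const.sub continuous_id).max continuous_const).aestronglyMeasurable
  have pos (c : ℝ) {Z : Ω → ℝ} (hZ : Integrable Z P) :
      Integrable (fun ω => max (c - Z ω) 0) P :=
    ((integrable_const c).sub hZ).sup (integrable_const 0)
  have key : ∫ ω, max (a * y + b * z - (a * X ω + b * Y ω)) 0 ∂P ≤
      a * ∫ ω, max (y - X ω) 0 ∂P + b * ∫ ω, max (z - Y ω) 0 ∂P := by
    rw [← integral_const_mul, ← integral_const_mul,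
      ← integral_add ((pos y iX).const_mul a) ((pos z iY).const_mul b)]
    refine integral_mono (pos _ ((iX.const_mul a).add (iY.const_mul b)))
      (((pos y iX).const_mul a).add ((pos z iY).const_mul b)) fun ω => ?_
    refine max_le ?_ ?_
    · have l1 := mul_le_mul_of_nonneg_left (le_max_left (y - X ω) 0) ha
      have l2 := mul_le_mul_of_nonneg_left (le_max_left (z - Y ω) 0) hb
      linarith
    · exact add_nonneg (mul_nonneg ha (le_max_right _ _)) (mul_nonneg hb (le_max_right _ _))
  have hZ : AEMeasurable (fun ω => a * X ω + b * Y ω) P := (hX.const_mul a).add (hY.const_mul b)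
  rw [hy, hz, law_smul_add_smul, law, law, integral_map hZ (sm _ _),
    integral_map hX (sm _ _), integral_map hY (sm _ _)]
  linarith

theorem choquet_superlinear (hq : 1 ≤ q) (hcv : ConvexOn ℝ (Icc (0 : ℝ) 1) h)
    (hc : ContinuousOn h (Icc 0 1)) (h0 : h 0 = 0)
    (hf : ∀ X : Lp ℝ q P, HasFiniteChoquet h (law X)) {a b : ℝ} (ha : 0 ≤ a) (hb : 0 ≤ b)
    (X Y : Lp ℝ q P) :
    a * choquet h (law X) + b * choquet h (law Y) ≤ choquet h (law (a • X + b • Y)) := by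
  have lim (Z : Lp ℝ q P) := tendsto_choquet_interp hcv hc h0 (integrable_law hq Z) (hf Z)
  refine le_of_tendsto_of_tendsto' (((lim X).const_mul a).add ((lim Y).const_mul b))
    (lim (a • X + b • Y)) fun n => ?_
  rw [(choquet_interp (integrable_law hq X) n).2, (choquet_interp (integrable_law hq Y) n).2,
    (choquet_interp (integrable_law hq (a • X + b • Y)) n).2, integral_law_smul_add_smul hq,
    mul_add, mul_add, Finset.mul_sum, Finset.mul_sum, add_add_add_comm, ← Finset.sum_add_distrib]
  refine add_le_add (by linarith) (Finset.sum_le_sum fun i hi => ?_)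
  have hi := Finset.mem_range.1 hi
  have := mul_le_mul_of_nonneg_left (choquet_hinge_superlinear hq ha hb X Y
    (node_interior hi).1 (node_interior hi).2) (interp_coeff_nonneg hcv hi)
  linarith

lemma choquet_mixture_le (hcv : ConvexOn ℝ (Icc (0 : ℝ) 1) h) {μ ν : Measure ℝ}
    [IsProbabilityMeasure μ] [IsProbabilityMeasure ν] {t : ℝ} (ht : t ∈ Icc (0 : ℝ) 1)
    (hμ : HasFiniteChoquet h μ) (hν : HasFiniteChoquet h ν)
    (hm : HasFiniteChoquet h (mixture t μ ν)) :
    choquet h (mixture t μ ν) ≤ t * choquet h μ + (1 - t) * choquet h ν := by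
  have hS (ρ : Measure ℝ) (x : ℝ) : 1 - cdf ρ x ∈ Icc (0 : ℝ) 1 :=
    ⟨by linarith [cdf_le_one ρ x], by linarith [cdf_nonneg ρ x]⟩
  have pt (x : ℝ) : h (1 - cdf (mixture t μ ν) x)
      ≤ t * h (1 - cdf μ x) + (1 - t) * h (1 - cdf ν x) := by
    have := hcv.2 (hS μ x) (hS ν x) ht.1 (by linarith [ht.2] : 0 ≤ 1 - t) (by ring)
    simp only [smul_eq_mul] at this
    rwa [show t * (1 - cdf μ x) + (1 - t) * (1 - cdf ν x) = 1 - cdf (mixture t μ ν) x by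
      rw [cdf_mixture ht]; ring] at this
  have a1 : ∫ x in Ioi (0 : ℝ), h (1 - cdf (mixture t μ ν) x) ≤
      t * (∫ x in Ioi (0 : ℝ), h (1 - cdf μ x)) + (1 - t) * ∫ x in Ioi (0 : ℝ), h (1 - cdf ν x) := by
    rw [← integral_const_mul, ← integral_const_mul,
      ← integral_add (hμ.1.const_mul t) (hν.1.const_mul (1 - t))]
    exact integral_mono hm.1 ((hμ.1.const_mul t).add (hν.1.const_mul (1 - t))) pt
  have a2 : ∫ x in Iio (0 : ℝ), (h (1 - cdf (mixture t μ ν) x) - h 1) ≤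
      t * (∫ x in Iio (0 : ℝ), (h (1 - cdf μ x) - h 1))
        + (1 - t) * ∫ x in Iio (0 : ℝ), (h (1 - cdf ν x) - h 1) := by
    rw [← integral_const_mul, ← integral_const_mul,
      ← integral_add (hμ.2.const_mul t) (hν.2.const_mul (1 - t))]
    refine integral_mono hm.2 ((hμ.2.const_mul t).add (hν.2.const_mul (1 - t))) fun x => ?_
    have := pt x
    simp only
    linarith
  simp only [choquet]
  linarith

end ConvexDistortion

/-! ### The uniform variable: realising laws, continuity, quantiles -/

section Uniform

variable {Ω : Type*} [MeasurableSpace Ω] {P : Measure Ω} {q : ℝ≥0∞} {U : Ω → ℝ}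

lemma real_preimage_Iic (hU : Measurable U)
    (hlaw : P.map U = (volume : Measure ℝ).restrict (Icc 0 1)) {s : ℝ} (hs : s ∈ Icc (0 : ℝ) 1) :
    P.real (U ⁻¹' Iic s) = s := by
  rw [← map_measureReal_apply hU measurableSet_Iic, hlaw,
    measureReal_restrict_apply measurableSet_Iic]
  have : Iic s ∩ Icc 0 1 = Icc 0 s := by
    ext x
    simp only [mem_inter_iff, mem_Iic, mem_Icc]
    exact ⟨fun h => ⟨h.2.1, h.1⟩, fun h => ⟨h.2, h.1, h.2.trans hs.2⟩⟩
  rw [this]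
  simp [hs.1]

lemma mem_lawsLp_of_memLp (hP : SupportsUniform P) {μ : Measure ℝ} [IsProbabilityMeasure μ]
    (hμ : MemLp (fun x => x) q μ) : μ ∈ lawsLp P q := by
  obtain ⟨U, hU, hlaw⟩ := hP
  obtain ⟨f, hf, hfμ⟩ := Measure.exists_measurable_map_eq μ
  -- The map `f` lives on the unit interval, while `U` may leave it on a null set; the projection
  -- makes the composition defined everywhere.
  have hproj : Measurable (projIcc (0 : ℝ) 1 zero_le_one) := continuous_projIcc.measurable
  have hX : Measurable fun ω => f (projIcc (0 : ℝ) 1 zero_le_one (U ω)) :=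
    hf.comp (hproj.comp hU)
  have e : P.map (fun ω => f (projIcc (0 : ℝ) 1 zero_le_one (U ω))) = μ := by
    change P.map ((f ∘ projIcc (0 : ℝ) 1 zero_le_one) ∘ U) = μ
    rw [← Measure.map_map (hf.comp hproj) hU, hlaw, ← unitInterval.measurePreserving_coe.map_eq,
      Measure.map_map (hf.comp hproj) measurable_subtype_coe]
    have : (f ∘ projIcc (0 : ℝ) 1 zero_le_one) ∘ ((↑) : unitInterval → ℝ) = f := by
      funext x
      exact congrArg f (projIcc_val zero_le_one x)
    rw [this, hfμ]
  have hmem : MemLp (fun ω => f (projIcc (0 : ℝ) 1 zero_le_one (U ω))) q P := by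
    rw [← e] at hμ
    exact hμ.comp_of_map hX.aemeasurable
  exact ⟨hmem.toLp _, (Measure.map_congr hmem.coeFn_toLp).trans e⟩

lemma memLp_law (X : Lp ℝ q P) : MemLp (fun x => x) q (law X) :=
  (memLp_map_measure_iff aestronglyMeasurable_id (aemeasurable_Lp X)).2 (Lp.memLp X)

lemma memLp_mixture (hq0 : q ≠ 0) (hq : q ≠ ∞) {μ ν : Measure ℝ} (t : ℝ)
    (hμ : MemLp (fun x => x) q μ) (hν : MemLp (fun x => x) q ν) :
    MemLp (fun x => x) q (mixture t μ ν) := by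
  have sm (ρ : Measure ℝ) : AEStronglyMeasurable (fun x : ℝ => x) ρ := aestronglyMeasurable_id
  rw [← integrable_norm_rpow_iff (sm _) hq0 hq] at hμ hν ⊢
  exact (hμ.smul_measure ENNReal.ofReal_ne_top).add_measure
    (hν.smul_measure ENNReal.ofReal_ne_top)

variable [IsProbabilityMeasure P]

lemma mixture_mem_lawsLp (hP : SupportsUniform P) (hq0 : q ≠ 0) (hq : q ≠ ∞) {t : ℝ}
    (ht : t ∈ Icc (0 : ℝ) 1) (X Y : Lp ℝ q P) : mixture t (law X) (law Y) ∈ lawsLp P q := by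
  have := isProbabilityMeasure_mixture (μ := law X) (ν := law Y) ht
  exact mem_lawsLp_of_memLp hP (memLp_mixture hq0 hq t (memLp_law X) (memLp_law Y))

lemma continuous_eventLp_preimage_Iic [Fact (1 ≤ q)] (hq : q ≠ ∞) (hU : Measurable U)
    (hlaw : P.map U = (volume : Measure ℝ).restrict (Icc 0 1)) :
    Continuous fun s : ℝ => eventLp P q (hU (measurableSet_Iic (a := s))) := by
  refine continuous_indicatorConstLp_set hq fun s => ?_
  have hlim : Tendsto (fun t : ℝ => ENNReal.ofReal |s - t|) (𝓝 s) (𝓝 0) := by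
    have : Continuous fun t : ℝ => ENNReal.ofReal |s - t| :=
      ENNReal.continuous_ofReal.comp (continuous_const.sub continuous_id).abs
    simpa using this.tendsto s
  refine tendsto_of_tendsto_of_tendsto_of_le_of_le tendsto_const_nhds hlim
    (fun t => zero_le) fun t => ?_
  have hsub : symmDiff (U ⁻¹' Iic t) (U ⁻¹' Iic s) ⊆ U ⁻¹' uIcc t s := by
    rintro ω (⟨h1, h2⟩ | ⟨h1, h2⟩)
    · exact mem_uIcc_of_ge (not_le.1 h2).le h1
    · exact mem_uIcc_of_le (not_le.1 h2).le h1
  calc P (symmDiff (U ⁻¹' Iic t) (U ⁻¹' Iic s)) ≤ P (U ⁻¹' uIcc t s) := measure_mono hsub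
    _ = (volume : Measure ℝ).restrict (Icc 0 1) (uIcc t s) := by
        rw [← hlaw, Measure.map_apply hU measurableSet_uIcc]
    _ ≤ volume (uIcc t s) := Measure.restrict_apply_le _ _
    _ = ENNReal.ofReal |s - t| := Real.volume_interval

lemma continuousOn_of_continuous_choquet [Fact (1 ≤ q)] (hq : q ≠ ∞) (hU : Measurable U)
    (hlaw : P.map U = (volume : Measure ℝ).restrict (Icc 0 1)) {h : ℝ → ℝ} (h0 : h 0 = 0)
    (hcont : Continuous fun X : Lp ℝ q P => choquet h (law X)) : ContinuousOn h (Icc 0 1) := by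
  refine (hcont.comp (continuous_eventLp_preimage_Iic hq hU hlaw)).continuousOn.congr
    fun s hs => ?_
  rw [Function.comp_apply, choquet_law_eventLp _ h0, real_preimage_Iic hU hlaw hs]

/-- `IsTwoStep μ 1 0 s s` is the Bernoulli law of parameter `s`. For `s < 1 - α` both level sets are
`Ici 0`, so the left and right quantiles coincide. -/
lemma mixedQuantile_of_lt {μ : Measure ℝ} {s α c : ℝ} (hμ : IsTwoStep μ 1 0 s s) (h0 : 0 < α)
    (hs : s < 1 - α) : mixedQuantile c α μ = 0 := by
  have val (x : ℝ) (hx : 0 ≤ x) : α < cdf μ x := by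
    refine lt_of_lt_of_le ?_ (monotone_cdf μ hx)
    rw [hμ.fst 0 ⟨le_rfl, one_pos⟩]
    linarith
  have e1 : {x | α < cdf μ x} = Ici 0 := by
    ext x
    refine ⟨fun h => ?_, fun h => val x h⟩
    by_contra hx
    have h : α < cdf μ x := h
    rw [hμ.neg x (not_le.1 hx)] at h
    linarith
  have e2 : {x | α ≤ cdf μ x} = Ici 0 := by
    ext x
    refine ⟨fun h => ?_, fun h => (val x h).le⟩
    by_contra hx
    have h : α ≤ cdf μ x := h
    rw [hμ.neg x (not_le.1 hx)] at h
    linarith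
  simp [mixedQuantile, rightQuantile, leftQuantile, e1, e2]

lemma mixedQuantile_of_gt {μ : Measure ℝ} {s α c : ℝ} (hμ : IsTwoStep μ 1 0 s s) (h1 : α < 1)
    (hs : 1 - α < s) : mixedQuantile c α μ = 1 := by
  have top (x : ℝ) (hx : 1 ≤ x) : cdf μ x = 1 := hμ.top x (by linarith)
  have low (x : ℝ) (hx : x < 1) : cdf μ x < α := by
    refine lt_of_le_of_lt (monotone_cdf μ (le_max_left x 0)) ?_
    rw [hμ.fst _ ⟨le_max_right _ _, max_lt hx one_pos⟩]
    linarith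
  have e1 : {x | α < cdf μ x} = Ici 1 := by
    ext x
    refine ⟨fun h => ?_, fun h => h1.trans_eq (top x h).symm⟩
    by_contra hx
    exact (low x (not_le.1 hx)).not_gt h
  have e2 : {x | α ≤ cdf μ x} = Ici 1 := by
    ext x
    refine ⟨fun h => ?_, fun h => h1.le.trans_eq (top x h).symm⟩
    by_contra hx
    exact (low x (not_le.1 hx)).not_ge h
  simp [mixedQuantile, rightQuantile, leftQuantile, e1, e2]

lemma not_continuous_mixedQuantile [Fact (1 ≤ q)] (hq : q ≠ ∞) (hP : SupportsUniform P)
    {α : ℝ} (hα : α ∈ Ioo (0 : ℝ) 1) (c : ℝ) :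
    ¬ Continuous fun X : Lp ℝ q P => mixedQuantile c α (law X) := by
  obtain ⟨U, hU, hlaw⟩ := hP
  intro hcont
  have hg := hcont.comp (continuous_eventLp_preimage_Iic hq hU hlaw)
  have step (s : ℝ) (hs : s ∈ Icc (0 : ℝ) 1) :
      IsTwoStep (law (eventLp P q (hU (measurableSet_Iic (a := s))))) 1 0 s s := by
    have := isTwoStep_law_nested (P := P) (q := q) (hU (measurableSet_Iic (a := s)))
      (hU (measurableSet_Iic (a := s))) subset_rfl zero_le_one le_rfl
    simpa [real_preimage_Iic hU hlaw hs] using this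
  -- Under continuity, the constant values on either side of `1 - α` extend to that point, where
  -- they would have to agree.
  have z0 := EqOn.closure (s := Ioo 0 (1 - α)) (g := fun _ => (0 : ℝ)) (fun s hs =>
    mixedQuantile_of_lt (step s ⟨hs.1.le, by linarith [hs.2, hα.1]⟩) hα.1 hs.2) hg continuous_const
  have z1 := EqOn.closure (s := Ioo (1 - α) 1) (g := fun _ => (1 : ℝ)) (fun s hs =>
    mixedQuantile_of_gt (step s ⟨by linarith [hs.1, hα.2], hs.2.le⟩) hα.2 hs.1) hg continuous_const
  rw [closure_Ioo (by linarith [hα.2])] at z0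
  rw [closure_Ioo (by linarith [hα.1])] at z1
  have a0 := z0 (right_mem_Icc.2 (by linarith [hα.2]))
  have a1 := z1 (left_mem_Icc.2 (by linarith [hα.1]))
  exact zero_ne_one (a0.symm.trans a1)

end Uniform

/-! ### Each property forces convexity of the distortion -/

section Necessity

variable {Ω : Type*} [MeasurableSpace Ω] {P : Measure Ω} [IsProbabilityMeasure P] {q : ℝ≥0∞}
  {h : ℝ → ℝ}

/-- Two events of equal probability whose indicators have a sum with prescribed distribution. -/
lemma exists_events_add_eq (hP : SupportsUniform P) {a b : ℝ} (ha : 0 ≤ a) (hab : a ≤ b)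
    (hb : b ≤ 1) : ∃ (A B M N : Set Ω) (hA : MeasurableSet A) (hB : MeasurableSet B)
      (hM : MeasurableSet M) (hN : MeasurableSet N), A ⊆ B ∧ P.real A = a ∧ P.real B = b ∧
      P.real M = (a + b) / 2 ∧ P.real N = (a + b) / 2 ∧
      eventLp P q hM + eventLp P q hN = eventLp P q hB + eventLp P q hA := by
  obtain ⟨U, hU, hlaw⟩ := hP
  have sub {s t : ℝ} (hst : s ≤ t) : U ⁻¹' Iic s ⊆ U ⁻¹' Iic t :=
    preimage_mono (Iic_subset_Iic.2 hst)
  have mA : MeasurableSet (U ⁻¹' Iic a) := hU measurableSet_Iic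
  have mB : MeasurableSet (U ⁻¹' Iic b) := hU measurableSet_Iic
  have mM : MeasurableSet (U ⁻¹' Iic ((a + b) / 2)) := hU measurableSet_Iic
  have sAM := sub (by linarith : a ≤ (a + b) / 2)
  have sMB := sub (by linarith : (a + b) / 2 ≤ b)
  have rA := real_preimage_Iic hU hlaw ⟨ha, hab.trans hb⟩
  have rB := real_preimage_Iic hU hlaw ⟨ha.trans hab, hb⟩
  have rM := real_preimage_Iic hU hlaw
    (⟨by linarith, by linarith⟩ : (a + b) / 2 ∈ Icc (0 : ℝ) 1)
  -- With `N = A ∪ (B \ M)` and `A ⊆ M ⊆ B`, one has `M ∩ N = A` and `M ∪ N = B`.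
  refine ⟨_, _, _, U ⁻¹' Iic a ∪ (U ⁻¹' Iic b \ U ⁻¹' Iic ((a + b) / 2)), mA, mB, mM,
    mA.union (mB.diff mM), sub hab, rA, rB, rM, ?_, ?_⟩
  · rw [measureReal_union (disjoint_sdiff_right.mono_left sAM) (mB.diff mM),
      measureReal_sdiff sMB mM, rA, rB, rM]
    ring
  · refine Lp.ext ?_
    have c1 := coeFn_nested (P := P) (q := q) mM (mA.union (mB.diff mM)) 1 1
    have c2 := coeFn_nested (P := P) (q := q) mB mA 1 1
    rw [one_smul, one_smul] at c1 c2
    filter_upwards [c1, c2] with ω h1 h2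
    rw [h1, h2]
    by_cases i1 : ω ∈ U ⁻¹' Iic a
    · have i2 := sAM i1
      have i3 := sMB i2
      rw [indicator_of_mem i2, indicator_of_mem (mem_union_left _ i1), indicator_of_mem i3,
        indicator_of_mem i1]
    · by_cases i2 : ω ∈ U ⁻¹' Iic ((a + b) / 2)
      · rw [indicator_of_mem i2, indicator_of_notMem (fun h => h.elim i1 fun h => h.2 i2),
          indicator_of_mem (sMB i2), indicator_of_notMem i1]
      · by_cases i3 : ω ∈ U ⁻¹' Iic b
        · rw [indicator_of_notMem i2,
            indicator_of_mem (mem_union_right _ (mem_sdiff_of_mem i3 i2)), indicator_of_mem i3,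
            indicator_of_notMem i1, add_comm]
        · rw [indicator_of_notMem i2, indicator_of_notMem (fun h => h.elim i1 fun h => i3 h.1),
            indicator_of_notMem i3, indicator_of_notMem i1]

lemma midpoint_le_of_superadditive (hP : SupportsUniform P) (h0 : h 0 = 0)
    (H : ∀ X Y : Lp ℝ q P, choquet h (law X) + choquet h (law Y) ≤ choquet h (law (X + Y)))
    {a b : ℝ} (ha : 0 ≤ a) (hab : a ≤ b) (hb : b ≤ 1) : 2 * h ((a + b) / 2) ≤ h a + h b := by
  obtain ⟨A, B, M, N, hA, hB, hM, hN, hAB, rA, rB, rM, rN, e⟩ :=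
    exists_events_add_eq (q := q) hP ha hab hb
  have := H (eventLp P q hM) (eventLp P q hN)
  have k := choquet_law_nested (P := P) (q := q) hB hA hAB zero_le_one zero_le_one h0
  rw [one_smul, one_smul] at k
  rw [e, choquet_law_eventLp hM h0, choquet_law_eventLp hN h0, k, rA, rB, rM, rN] at this
  linarith

lemma midpoint_le_of_quasiconcave (hP : SupportsUniform P) (h0 : h 0 = 0)
    (H : QuasiconcaveOn ℝ univ fun X : Lp ℝ q P => choquet h (law X))
    {a b : ℝ} (ha : 0 ≤ a) (hab : a ≤ b) (hb : b ≤ 1) : 2 * h ((a + b) / 2) ≤ h a + h b := by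
  obtain ⟨A, B, M, N, hA, hB, hM, hN, hAB, rA, rB, rM, rN, e⟩ :=
    exists_events_add_eq (q := q) hP ha hab hb
  -- Both indicators lie in the superlevel set at `h ((a + b) / 2)`, hence so does their midpoint,
  -- whose value is `(h a + h b) / 2`.
  have hh : (0 : ℝ) ≤ 1 / 2 := by norm_num
  have k := choquet_law_nested (P := P) (q := q) hB hA hAB hh hh h0
  have lM : h ((a + b) / 2) ≤ choquet h (law (eventLp P q hM)) := by
    rw [choquet_law_eventLp hM h0, rM]
  have lN : h ((a + b) / 2) ≤ choquet h (law (eventLp P q hN)) := by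
    rw [choquet_law_eventLp hN h0, rN]
  have := (H (h ((a + b) / 2)) ⟨mem_univ _, lM⟩ ⟨mem_univ _, lN⟩ hh hh (by norm_num)).2
  simp only at this
  rw [← smul_add, e, smul_add, k, rA, rB] at this
  linarith

lemma midpoint_le_of_concaveOrderMonotone (hP : SupportsUniform P) (h0 : h 0 = 0)
    (H : ConcaveOrderMonotoneOn (lawsLp P q) (choquet h))
    {a b : ℝ} (ha : 0 ≤ a) (hab : a ≤ b) (hb : b ≤ 1) : 2 * h ((a + b) / 2) ≤ h a + h b := by
  obtain ⟨A, B, M, N, hA, hB, hM, hN, hAB, rA, rB, rM, rN, e⟩ :=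
    exists_events_add_eq (q := q) hP ha hab hb
  -- The laws compared are those of `2 · 1_M` and `1_A + 1_B`. The latter moves mass from `{0, 2}`
  -- to `1` with the mean kept, which raises integrals of concave functions.
  have := H _ ⟨(1 : ℝ) • eventLp P q hM + (1 : ℝ) • eventLp P q hM, rfl⟩ _
    ⟨(1 : ℝ) • eventLp P q hB + (1 : ℝ) • eventLp P q hA, rfl⟩ fun f hf _ => by
      have fm : Measurable f := (continuousOn_univ.1 (hf.continuousOn isOpen_univ)).measurable
      obtain ⟨-, e1⟩ := integral_law_nested (P := P) (q := q) hM hM subset_rfl 1 1 fm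
      obtain ⟨i2, e2⟩ := integral_law_nested (P := P) (q := q) hB hA hAB 1 1 fm
      refine ⟨i2, ?_⟩
      rw [e1, e2, rA, rB, rM]
      have hh : (0 : ℝ) ≤ 1 / 2 := by norm_num
      have c := hf.2 (mem_univ (0 : ℝ)) (mem_univ (1 + 1 : ℝ)) hh hh (by norm_num)
      simp only [smul_eq_mul] at c
      rw [show (1 / 2 * 0 + 1 / 2 * (1 + 1) : ℝ) = 1 by norm_num] at c
      nlinarith
  rw [choquet_law_nested hM hM subset_rfl zero_le_one zero_le_one h0,
    choquet_law_nested hB hA hAB zero_le_one zero_le_one h0, rA, rB, rM] at this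
  linarith

lemma convexOn_of_mQuasiConvex (hP : SupportsUniform P) (h0 : h 0 = 0)
    (hc : ContinuousOn h (Icc 0 1)) (H : MQuasiConvexOn (lawsLp P q) (choquet h)) :
    ConvexOn ℝ (Icc (0 : ℝ) 1) h := by
  obtain ⟨U, hU, hlaw⟩ := hP
  refine convexOn_of_weighted_quasiconvex hc
    fun s₁ hs₁ s₂ hs₂ t₁ ht₁ t₂ ht₂ hs ht d₁ d₂ hd₁ hd₂ => ?_
  have two {s₁ s₂ : ℝ} (hs₁ : s₁ ∈ Icc (0 : ℝ) 1) (hs₂ : s₂ ∈ Icc (0 : ℝ) 1) (hs : s₂ ≤ s₁) :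
      ∃ X : Lp ℝ q P, IsTwoStep (law X) d₁ d₂ s₁ s₂ := by
    have := isTwoStep_law_nested (P := P) (q := q) (hU (measurableSet_Iic (a := s₁)))
      (hU (measurableSet_Iic (a := s₂))) (preimage_mono (Iic_subset_Iic.2 hs)) hd₁ hd₂
    rw [real_preimage_Iic hU hlaw hs₁, real_preimage_Iic hU hlaw hs₂] at this
    exact ⟨_, this⟩
  obtain ⟨X, hX⟩ := two hs₁ hs₂ hs
  obtain ⟨Y, hY⟩ := two ht₁ ht₂ ht
  have half : (1 / 2 : ℝ) ∈ Icc (0 : ℝ) 1 := by constructor <;> norm_num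
  have := H _ ⟨X, rfl⟩ _ ⟨Y, rfl⟩ (1 / 2) half
  rw [(hX.mixture hY half).choquet_eq h0 hd₁ hd₂, hX.choquet_eq h0 hd₁ hd₂,
    hY.choquet_eq h0 hd₁ hd₂] at this
  have e (x y : ℝ) : 1 / 2 * x + (1 - 1 / 2) * y = (x + y) / 2 := by ring
  rwa [e, e] at this

end Necessity

end SignedChoquet

/-! ### Assembly of the equivalences -/

theorem mainTheorem5 {Ω : Type*} [MeasurableSpace Ω] (P : Measure Ω) [IsProbabilityMeasure P]
    (hP : SignedChoquet.SupportsUniform P) (q : ℝ≥0∞) [Fact (1 ≤ q)] (hq : q ≠ ∞) :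
    (∀ h : ℝ → ℝ, SignedChoquet.IsDistortion h →
      (∀ X : Lp ℝ q P, SignedChoquet.HasFiniteChoquet h (SignedChoquet.law X)) →
      Continuous (fun X : Lp ℝ q P => SignedChoquet.choquet h (SignedChoquet.law X)) →
      List.TFAE
        [ConvexOn ℝ (Icc (0 : ℝ) 1) h,
          SignedChoquet.ConcaveOrderMonotoneOn (SignedChoquet.lawsLp P q)
            (SignedChoquet.choquet h),
          ∀ X Y : Lp ℝ q P,
            SignedChoquet.choquet h (SignedChoquet.law X)
              + SignedChoquet.choquet h (SignedChoquet.law Y)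
              ≤ SignedChoquet.choquet h (SignedChoquet.law (X + Y)),
          ConcaveOn ℝ univ (fun X : Lp ℝ q P => SignedChoquet.choquet h (SignedChoquet.law X)),
          QuasiconcaveOn ℝ univ
            (fun X : Lp ℝ q P => SignedChoquet.choquet h (SignedChoquet.law X)),
          SignedChoquet.MConvexOn (SignedChoquet.lawsLp P q) (SignedChoquet.choquet h),
          SignedChoquet.MQuasiConvexOn (SignedChoquet.lawsLp P q) (SignedChoquet.choquet h)]) ∧
    (∀ α ∈ Ioo (0 : ℝ) 1, ∀ c ∈ Icc (0 : ℝ) 1,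
      ¬ Continuous (fun X : Lp ℝ q P =>
        SignedChoquet.mixedQuantile c α (SignedChoquet.law X))) := by
  have hq1 : 1 ≤ q := Fact.out
  refine ⟨fun h hh hfin hcont => ?_, fun α hα c _ =>
    SignedChoquet.not_continuous_mixedQuantile hq hP hα c⟩
  have h0 := hh.map_zero
  have hc : ContinuousOn h (Icc 0 1) := by
    obtain ⟨U, hU, hlaw⟩ := hP
    exact SignedChoquet.continuousOn_of_continuous_choquet hq hU hlaw h0 hcont
  tfae_have 1 → 2 := by
    rintro hcv _ ⟨X, rfl⟩ _ ⟨Y, rfl⟩ hle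
    exact SignedChoquet.choquet_le_of_concaveOrderLE hcv hc h0 (SignedChoquet.integrable_law hq1 X)
      (SignedChoquet.integrable_law hq1 Y) (hfin X) (hfin Y) hle
  tfae_have 2 → 1 := fun H => SignedChoquet.convexOn_of_midpoint hc fun _ _ ha hab hb =>
    SignedChoquet.midpoint_le_of_concaveOrderMonotone hP h0 H ha hab hb
  tfae_have 1 → 3 := fun hcv X Y => by
    simpa using SignedChoquet.choquet_superlinear hq1 hcv hc h0 hfin zero_le_one zero_le_one X Y
  tfae_have 3 → 1 := fun H => SignedChoquet.convexOn_of_midpoint hc fun _ _ ha hab hb =>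
    SignedChoquet.midpoint_le_of_superadditive hP h0 H ha hab hb
  tfae_have 1 → 4 := fun hcv => ⟨convex_univ, fun X _ Y _ _ _ ha hb _ =>
    SignedChoquet.choquet_superlinear hq1 hcv hc h0 hfin ha hb X Y⟩
  tfae_have 4 → 5 := fun H => H.quasiconcaveOn
  tfae_have 5 → 1 := fun H => SignedChoquet.convexOn_of_midpoint hc fun _ _ ha hab hb =>
    SignedChoquet.midpoint_le_of_quasiconcave hP h0 H ha hab hb
  tfae_have 1 → 6 := by
    rintro hcv _ ⟨X, rfl⟩ _ ⟨Y, rfl⟩ t ht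
    -- The mixture is itself the law of some `Z` in `L^q`, so `hfin Z` gives finiteness of its
    -- integrals.
    obtain ⟨Z, hZ⟩ := SignedChoquet.mixture_mem_lawsLp hP
      (zero_lt_one.trans_le hq1).ne' hq ht X Y
    exact SignedChoquet.choquet_mixture_le hcv ht (hfin X) (hfin Y) (hZ ▸ hfin Z)
  tfae_have 6 → 7 := by
    intro H μ hμ ν hν t ht
    refine (H μ hμ ν hν t ht).trans ?_
    have l1 := mul_le_mul_of_nonneg_left
      (le_max_left (SignedChoquet.choquet h μ) (SignedChoquet.choquet h ν)) ht.1
    have l2 := mul_le_mul_of_nonneg_left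
      (le_max_right (SignedChoquet.choquet h μ) (SignedChoquet.choquet h ν)) (sub_nonneg.2 ht.2)
    linarith
  tfae_have 7 → 1 := SignedChoquet.convexOn_of_mQuasiConvex hP h0 hc
  tfae_finish
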